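/- Let $K$ be a field of arbitrary characteristic. A Poisson algebra over $K$ is a commutative associative unital $K$-algebra $P$ with a $K$-bilinear Lie bracket $\{\cdot,\cdot\}$ such that $\{x,yz\}=\{x,y\}z+y\{x,z\}$ for all $x,y,z\in P$. Its Poisson centre is ${\rm PZ}(P)=\{z\in P \mid \{z,x\}=0 \text{ for all } x\in P\}$; an ideal $I$ of $P$ is a Poisson ideal if $\{P,I\}\subseteq I$. The Poisson enveloping algebra ${\cal U}(P)$ is the associative unital $K$-algebra generated by the algebra $P$ and elements $\delta_x$ ($x\in P$), $K$-linear in $x$, subject to the defining relations $[\delta_x,\delta_y]=\delta_{\{x,y\}}$, $[\delta_x,y]=\{x,y\}$ and $\delta_{xy}=x\delta_y+y\delta_x$ for all $x,y\in P$. The algebra $P$ is a left ${\cal U}(P)$-module, where $x\in P$ acts by multiplication and $\delta_x$ acts as $\{x,\cdot\}$. Let $D$ be a Poisson algebra over $K$, let $n\ge 0$, let $\partial=(\partial_1,\ldots,\partial_n)$ be pairwise commuting $K$-derivations of $D$ with $\partial_i(\{x,y\})=\{\partial_i(x),y\}+\{x,\partial_i(y)\}$ for all $x,y\in D$, and let $a=(a_1,\ldots,a_n)\in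 {\rm PZ}(D)^n$ be such that $\partial_i(a_j)=0$ for all $i\ne j$. Let $A=D[X,Y;a,\partial\}$ be the generalized Weyl Poisson algebra of rank $n$, that is, the commutative algebra $D[X_1,\ldots,X_n,Y_1,\ldots,Y_n]/(X_1Y_1-a_1,\ldots,X_nY_n-a_n)$ with the Poisson bracket that extends the bracket of $D$ and satisfies, for all $d\in D$ and all $i$, $\{Y_i,d\}=\partial_i(d)Y_i$, $\{X_i,d\}=-\partial_i(d)X_i$, $\{Y_i,X_i\}=\partial_i(a_i)$, and $\{X_i,X_j\}=\{X_i,Y_j\}=\{Y_i,Y_j\}=0$ for all $i\neq j$. Then the following statements are equivalent: 1. The algebra ${\cal U}(A)$ is a simple algebra (it is nonzero and its only two-sided ideals are $0$ and itself). 2. (a) The only Poisson ideals $I$ of $D$ with $\partial_i(I)\subseteq I$ for all $i=1,\ldots,n$ are $0$ and $D$; (b) $Da_i+D\partial_i(a_i)=D$ for all $i=1,\ldots,n$; (c) the algebra ${\rm PZ}(A)$ is a field; and (d) the left ${\cal U}(A)$-module $A$ is faithful. -/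

import Mathlib

open MvPolynomial

noncomputable section

/-- A Poisson algebra over `K`: a commutative associative unital `K`-algebra with a `K`-bilinear
Lie bracket satisfying the Leibniz rule. -/
class PoissonAlgebra (K A : Type*) [CommRing K] [CommRing A] [Algebra K A] where
  bracket : A →ₗ[K] A →ₗ[K] A
  bracket_self : ∀ x, bracket x x = 0
  jacobi : ∀ x y z, bracket x (bracket y z) + bracket y (bracket z x) + bracket z (bracket x y) = 0
  leibniz : ∀ x y z, bracket x (y * z) = bracket x y * z + y * bracket x z

namespace PoissonAlgebra

section
variable (K : Type*) {A : Type*} [CommRing K] [CommRing A] [Algebra K A] [PoissonAlgebra K A]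

/-- The Poisson bracket `{x, y}`. -/
abbrev pbr (x y : A) : A := bracket (K := K) x y

theorem pbr_skew (x y : A) : pbr K x y = -pbr K y x := by
  have h := bracket_self (K := K) (x + y)
  simp only [map_add, LinearMap.add_apply, bracket_self, zero_add, add_zero] at h
  exact eq_neg_of_add_eq_zero_right h

theorem pbr_mul_left (x y z : A) : pbr K (x * y) z = x * pbr K y z + y * pbr K x z := by
  rw [pbr_skew, pbr, leibniz, ← pbr, ← pbr, pbr_skew K z x, pbr_skew K z y]; ring

theorem pbr_add_left (x y z : A) : pbr K (x + y) z = pbr K x z + pbr K y z := by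
  simp [pbr]

theorem pbr_smul_left (r : K) (x y : A) : pbr K (r • x) y = r • pbr K x y := by
  simp [pbr]

/-- The derivation `pad_x = {x, ·}` of the associative algebra `A`. -/
def pad (x : A) : Derivation K A A :=
  Derivation.mk' (bracket (K := K) x) fun y z => by
    rw [leibniz, smul_eq_mul, smul_eq_mul]; ring

@[simp] theorem pad_apply (x y : A) : pad K x y = pbr K x y := rfl

/-- A derivation `δ` of the associative algebra `A` is a Poisson derivation if
`δ {x, y} = {δ x, y} + {x, δ y}`. -/
def IsPoissonDerivation (δ : Derivation K A A) : Prop :=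
  ∀ x y, δ (pbr K x y) = pbr K (δ x) y + pbr K x (δ y)

/-- A Poisson ideal: an ideal `I` of the associative algebra with `{A, I} ⊆ I`. -/
def IsPoissonIdeal (I : Ideal A) : Prop := ∀ x, ∀ y ∈ I, pbr K x y ∈ I

end

section
variable (K A : Type*) [CommRing K] [CommRing A] [Algebra K A] [PoissonAlgebra K A]

/-- The Poisson centre `PZ(A) = {z | {z, x} = 0 for all x}`, a subalgebra of `A`. -/
def center : Subalgebra K A where
  carrier := {z | ∀ x, pbr K z x = 0}
  mul_mem' {a b} ha hb x := by
    rw [pbr_mul_left, ha x, hb x, mul_zero, mul_zero, add_zero]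
  add_mem' {a b} ha hb x := by
    have h1 := ha x
    have h2 := hb x
    simp only [pbr] at h1 h2 ⊢
    rw [map_add, LinearMap.add_apply, h1, h2, add_zero]
  algebraMap_mem' r x := by
    rw [pbr_skew]
    exact neg_eq_zero.mpr ((pad K x).map_algebraMap r)

end

end PoissonAlgebra

open PoissonAlgebra

/-! ### The Poisson enveloping algebra -/

section Enveloping
variable (K A : Type*) [CommRing K] [CommRing A] [Algebra K A] [PoissonAlgebra K A]

/-- The free associative algebra on symbols `a` (`Sum.inl a`) and `δ_a` (`Sum.inr a`), `a ∈ A`. -/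
abbrev PoissonEnv.Free := FreeAlgebra K (A ⊕ A)

variable {A} in
/-- The symbol `a`, for `a ∈ A`. -/
abbrev PoissonEnv.coe (a : A) : PoissonEnv.Free K A := FreeAlgebra.ι K (Sum.inl a)

variable {A} in
/-- The symbol `δ_a`, for `a ∈ A`. -/
abbrev PoissonEnv.del (a : A) : PoissonEnv.Free K A := FreeAlgebra.ι K (Sum.inr a)

open PoissonEnv in
/-- The defining relations of the Poisson enveloping algebra. The first three say that the symbols
`a` satisfy the relations of the `K`-algebra `A`. -/
inductive PoissonEnv.Rel : PoissonEnv.Free K A → PoissonEnv.Free K A → Prop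
  | coe_add (a b : A) : Rel (coe K (a + b)) (coe K a + coe K b)
  | coe_mul (a b : A) : Rel (coe K (a * b)) (coe K a * coe K b)
  | coe_algebraMap (r : K) : Rel (coe K (algebraMap K A r)) (algebraMap K (PoissonEnv.Free K A) r)
  | del_add (a b : A) : Rel (del K (a + b)) (del K a + del K b)
  | del_smul (r : K) (a : A) : Rel (del K (r • a)) (r • del K a)
  | del_bracket (a b : A) : Rel (del K (pbr K a b)) (del K a * del K b - del K b * del K a)
  | del_coe (a b : A) : Rel (coe K (pbr K a b)) (del K a * coe K b - coe K b * del K a)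
  | del_mul (a b : A) : Rel (del K (a * b)) (coe K a * del K b + coe K b * del K a)

/-- The Poisson enveloping algebra `𝒰(A)`: generated by the algebra `A` and elements `δ_a`, `K`-linear
in `a`, with `[δ_a, δ_b] = δ_{a,b}`, `[δ_a, b] = {a, b}` and `δ_{ab} = a δ_b + b δ_a`. -/
def PoissonEnv := RingQuot (PoissonEnv.Rel K A)

instance : Ring (PoissonEnv K A) := inferInstanceAs (Ring (RingQuot (PoissonEnv.Rel K A)))

instance : Algebra K (PoissonEnv K A) :=
  inferInstanceAs (Algebra K (RingQuot (PoissonEnv.Rel K A)))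

/-- The natural representation `𝒰(A) → End_K(A)`, in which `a` acts by multiplication
and `δ_a` acts by `pad_a = {a, ·}`. -/
def PoissonEnv.rep : PoissonEnv K A →ₐ[K] Module.End K A :=
  RingQuot.liftAlgHom K ⟨FreeAlgebra.lift K
    (Sum.elim (fun a => LinearMap.mulLeft K a) (fun a => bracket (K := K) a)), by
    intro x y h
    induction h with
    | coe_add a b => ext c; simp [add_mul]
    | coe_mul a b => ext c; simp
    | coe_algebraMap r => ext c; simp [Algebra.smul_def]
    | del_add a b => ext c; simp
    | del_smul r a => ext c; simp
    | del_bracket a b =>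
      ext c
      have h := jacobi (K := K) a b c
      have h1 : bracket (K := K) b (bracket (K := K) c a)
          = -bracket (K := K) b (bracket (K := K) a c) := by
        rw [← map_neg]; exact congrArg _ (pbr_skew K c a)
      have h2 := pbr_skew K c (bracket (K := K) a b)
      simp only [pbr] at h2
      rw [h1, h2] at h
      simp
      linear_combination -h
    | del_coe a b => ext c; simp [leibniz]
    | del_mul a b =>
      ext c
      simpa using pbr_mul_left K a b c⟩

/-- The natural left `𝒰(A)`-module structure on `A`. -/
instance : Module (PoissonEnv K A) A := Module.compHom A (PoissonEnv.rep K A).toRingHom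

end Enveloping

/-! ### Generalized Weyl Poisson algebras -/

/-- The data defining a generalized Weyl Poisson algebra of rank `n` over the Poisson algebra `D`:
commuting Poisson derivations `∂ 1, …, ∂ n` of `D` and elements `a 1, …, a n` of the
Poisson centre of `D` with `∂ i (a j) = 0` for `i ≠ j`. -/
structure GWPAData (K D : Type*) [CommRing K] [CommRing D] [Algebra K D] [PoissonAlgebra K D]
    (n : ℕ) where
  der : Fin n → Derivation K D D
  der_poisson : ∀ i, IsPoissonDerivation K (der i)
  der_comm : ∀ i j d, der i (der j d) = der j (der i d)
  a : Fin n → D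
  a_mem : ∀ i, a i ∈ PoissonAlgebra.center K D
  der_a : ∀ i j, i ≠ j → der i (a j) = 0

namespace GWPAData

section Ext
variable {K D σ : Type*} [CommRing K] [CommRing D] [Algebra K D]

theorem der_eqOn {δ₁ δ₂ : Derivation K (MvPolynomial σ D) (MvPolynomial σ D)}
    (hC : ∀ d, δ₁ (C d) = δ₂ (C d)) (hX : ∀ i, δ₁ (X i) = δ₂ (X i)) : δ₁ = δ₂ := by
  refine Derivation.ext fun f => ?_
  induction f using MvPolynomial.induction_on with
  | C d => exact hC d
  | add p q hp hq => rw [map_add, map_add, hp, hq]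
  | mul_X p i hp => rw [Derivation.leibniz, Derivation.leibniz, hp, hX]

/-- The ring homomorphism `f ↦ f + ε δ(f)` into the dual numbers, where `δ` extends a
given derivation `D → D[σ]` and takes given values on the variables. -/
def extHom (δ : Derivation K D (MvPolynomial σ D)) (v : σ → MvPolynomial σ D) :
    MvPolynomial σ D →+* DualNumber (MvPolynomial σ D) :=
  eval₂Hom
    { toFun := fun d => TrivSqZeroExt.inl (C d) + TrivSqZeroExt.inr (δ d)
      map_one' := by ext <;> simp
      map_zero' := by ext <;> simp
      map_mul' := fun x y => by
        refine TrivSqZeroExt.ext (by simp) ?_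
        simp only [TrivSqZeroExt.snd_add, TrivSqZeroExt.snd_inl, TrivSqZeroExt.snd_inr, zero_add,
          TrivSqZeroExt.snd_mul, TrivSqZeroExt.fst_add, TrivSqZeroExt.fst_inl,
          TrivSqZeroExt.fst_inr, add_zero, Derivation.leibniz, MulOpposite.smul_eq_mul_unop,
          MulOpposite.unop_op, smul_eq_mul, smul_eq_C_mul]
        ring
      map_add' := fun x y => by ext <;> simp }
    (fun i => TrivSqZeroExt.inl (X i) + TrivSqZeroExt.inr (v i))

theorem fst_extHom (δ : Derivation K D (MvPolynomial σ D)) (v : σ → MvPolynomial σ D)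
    (f : MvPolynomial σ D) : (extHom δ v f).fst = f := by
  induction f using MvPolynomial.induction_on with
  | C d => simp [extHom]
  | add p q hp hq => rw [map_add, TrivSqZeroExt.fst_add, hp, hq]
  | mul_X p i hp => rw [map_mul, TrivSqZeroExt.fst_mul, hp]; simp [extHom]

/-- The `K`-derivation of `D[σ]` that extends a given derivation `δ : D → D[σ]` and takes given
values `v` on the variables. -/
def extDer (δ : Derivation K D (MvPolynomial σ D)) (v : σ → MvPolynomial σ D) :
    Derivation K (MvPolynomial σ D) (MvPolynomial σ D) :=
  Derivation.mk'
    { toFun := fun f => (extHom δ v f).snd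
      map_add' := fun f g => by simp
      map_smul' := fun r f => by
        have h : r • f = C (algebraMap K D r) * f := by
          rw [← algebraMap_eq, ← Algebra.smul_def, algebraMap_smul]
        rw [h, map_mul, TrivSqZeroExt.snd_mul, fst_extHom, fst_extHom]
        simp [extHom, Algebra.smul_def] }
    (fun f g => by simp [fst_extHom, mul_comm])

@[simp] theorem extDer_C (δ : Derivation K D (MvPolynomial σ D)) (v : σ → MvPolynomial σ D)
    (d : D) : extDer δ v (C d) = δ d := by
  simp [extDer, extHom]

@[simp] theorem extDer_X (δ : Derivation K D (MvPolynomial σ D)) (v : σ → MvPolynomial σ D)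
    (i : σ) : extDer δ v (X i) = v i := by
  simp [extDer, extHom]

/-- A derivation of `D`, seen with values in `D[σ]`. -/
def toPoly (δ : Derivation K D D) : Derivation K D (MvPolynomial σ D) :=
  (Algebra.linearMap D (MvPolynomial σ D)).compDer δ

@[simp] theorem toPoly_apply (δ : Derivation K D D) (d : D) :
    toPoly (σ := σ) δ d = C (δ d) := rfl

end Ext

variable {K D : Type*} [CommRing K] [CommRing D] [Algebra K D] [PoissonAlgebra K D] {n : ℕ}
variable (S : GWPAData K D n)

theorem der_pbr_a (i j : Fin n) (d : D) : pbr K d (S.der i (S.a j)) = 0 := by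
  have h := S.der_poisson i (S.a j) d
  have h1 : pbr K (S.a j) d = 0 := S.a_mem j d
  have h2 : pbr K (S.a j) (S.der i d) = 0 := S.a_mem j _
  rw [h1, h2, map_zero, add_zero] at h
  rw [pbr_skew, ← h, neg_zero]

theorem pbr_a (j : Fin n) (d : D) : pbr K d (S.a j) = 0 := by
  rw [pbr_skew, S.a_mem j d, neg_zero]

theorem der_der_a (i j : Fin n) (h : i ≠ j) : S.der j (S.der i (S.a i)) = 0 := by
  rw [S.der_comm, S.der_a j i h.symm, map_zero]

theorem der_der_a' (i j : Fin n) (h : ¬i = j) : S.der i (S.der j (S.a j)) = 0 :=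
  S.der_der_a j i (Ne.symm h)

/-- The polynomial algebra `D[X_1, …, X_n, Y_1, …, Y_n]`;
the variable `Sum.inl i` is `X_i` and the variable `Sum.inr i` is `Y_i`. -/
abbrev Poly (_S : GWPAData K D n) := MvPolynomial (Fin n ⊕ Fin n) D

/-- The variable `X_i`. -/
abbrev pX (i : Fin n) : S.Poly := X (Sum.inl i)

/-- The variable `Y_i`. -/
abbrev pY (i : Fin n) : S.Poly := X (Sum.inr i)

/-- The derivation `{d, ·}` of `D[X, Y]`, for `d ∈ D`:
`{d, X_i} = ∂_i(d) X_i` and `{d, Y_i} = -∂_i(d) Y_i`. -/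
def hamC (d : D) : Derivation K S.Poly S.Poly :=
  extDer (toPoly (pad K d))
    (Sum.elim (fun i => C (S.der i d) * S.pX i) (fun i => -(C (S.der i d) * S.pY i)))

/-- The derivations `{X_i, ·}` and `{Y_i, ·}` of `D[X, Y]`: `{X_i, d} = -∂_i(d) X_i`,
`{Y_i, d} = ∂_i(d) Y_i`, `{Y_i, X_i} = ∂_i(a_i) = -{X_i, Y_i}`, and all the other brackets
of variables are zero. -/
def hamX : Fin n ⊕ Fin n → Derivation K S.Poly S.Poly
  | Sum.inl i => extDer (-(S.pX i • toPoly (S.der i)))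
      (Sum.elim (fun _ => 0) (fun j => if i = j then -C (S.der i (S.a i)) else 0))
  | Sum.inr i => extDer (S.pY i • toPoly (S.der i))
      (Sum.elim (fun j => if i = j then C (S.der i (S.a i)) else 0) (fun _ => 0))

@[simp] theorem hamC_C (d e : D) : S.hamC d (C e) = C (pbr K d e) := by simp [hamC]
@[simp] theorem hamC_X (d : D) (i) : S.hamC d (S.pX i) = C (S.der i d) * S.pX i := by simp [hamC]
@[simp] theorem hamC_Y (d : D) (i) : S.hamC d (S.pY i) = -(C (S.der i d) * S.pY i) := by
  simp [hamC]
@[simp] theorem hamX_X_C (i) (d : D) : S.hamX (Sum.inl i) (C d) = -(C (S.der i d) * S.pX i) := by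
  simp [hamX, mul_comm]
@[simp] theorem hamX_Y_C (i) (d : D) : S.hamX (Sum.inr i) (C d) = C (S.der i d) * S.pY i := by
  simp [hamX, mul_comm]
@[simp] theorem hamX_X_X (i j) : S.hamX (Sum.inl i) (S.pX j) = 0 := by simp [hamX]
@[simp] theorem hamX_Y_Y (i j) : S.hamX (Sum.inr i) (S.pY j) = 0 := by simp [hamX]
@[simp] theorem hamX_X_Y (i j) :
    S.hamX (Sum.inl i) (S.pY j) = if i = j then -C (S.der i (S.a i)) else 0 := by simp [hamX]
@[simp] theorem hamX_Y_X (i j) :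
    S.hamX (Sum.inr i) (S.pX j) = if i = j then C (S.der i (S.a i)) else 0 := by simp [hamX]

theorem hamC_add (d e : D) : S.hamC (d + e) = S.hamC d + S.hamC e := by
  refine der_eqOn (fun c => by simp [pbr_add_left]) ?_
  rintro (i | i) <;> simp <;> ring

theorem hamC_smul (r : K) (d : D) : S.hamC (r • d) = r • S.hamC d := by
  refine der_eqOn (fun c => ?_) ?_
  · simp only [hamC_C, Derivation.smul_apply, pbr_smul_left]
    simp only [C_eq_smul_one, smul_assoc]
  · rintro (i | i) <;> simp [C_eq_smul_one, smul_assoc]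

theorem hamC_mul (d e : D) :
    S.hamC (d * e) = (C d : S.Poly) • S.hamC e + (C e : S.Poly) • S.hamC d := by
  refine der_eqOn (fun c => ?_) ?_
  · simp [pbr_mul_left K]
  · rintro (i | i) <;> simp <;> ring

/-- For fixed `f`, the derivation `{·, f}` restricted to `D`. -/
def hamD (f : S.Poly) : Derivation K D S.Poly :=
  Derivation.mk'
    { toFun := fun d => S.hamC d f
      map_add' := fun d e => by simp [hamC_add]
      map_smul' := fun r d => by simp [hamC_smul] }
    (fun d e => by simp [hamC_mul, Algebra.smul_def, algebraMap_eq])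

@[simp] theorem hamD_apply (f : S.Poly) (d : D) : S.hamD f d = S.hamC d f := rfl

/-- The derivation `{f, ·}` of `D[X, Y]`, determined by `{f, d} = -{d, f}`, `{f, X_i} = -{X_i, f}`
and `{f, Y_i} = -{Y_i, f}`. -/
def ham (f : S.Poly) : Derivation K S.Poly S.Poly :=
  extDer (-S.hamD f) (fun s => -S.hamX s f)

@[simp] theorem ham_apply_C (f : S.Poly) (d : D) : S.ham f (C d) = -S.hamC d f := by simp [ham]
@[simp] theorem ham_apply_X (f : S.Poly) (s) : S.ham f (X s) = -S.hamX s f := by simp [ham]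

theorem ham_add (f g : S.Poly) : S.ham (f + g) = S.ham f + S.ham g := by
  refine der_eqOn (fun c => ?_) (fun s => ?_) <;> simp <;> ring

theorem ham_smul (r : K) (f : S.Poly) : S.ham (r • f) = r • S.ham f := by
  refine der_eqOn (fun c => ?_) (fun s => ?_) <;> simp

theorem ham_mul (f g : S.Poly) : S.ham (f * g) = f • S.ham g + g • S.ham f := by
  refine der_eqOn (fun c => ?_) (fun s => ?_) <;> simp <;> ring

@[simp] theorem ham_C (d : D) : S.ham (C d) = S.hamC d := by
  refine der_eqOn (fun c => ?_) ?_
  · simp [pbr_skew K d c]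
  · rintro (i | i) <;> simp

@[simp] theorem ham_X (s) : S.ham (X s) = S.hamX s := by
  refine der_eqOn (fun c => ?_) ?_
  · rcases s with i | i <;> simp
  · rcases s with i | i <;> rintro (j | j) <;> simp
    · by_cases h : i = j
      · subst h; simp
      · simp [h, Ne.symm h]
    · by_cases h : i = j
      · subst h; simp
      · simp [h, Ne.symm h]

theorem ham_skew (f g : S.Poly) : S.ham f g = -S.ham g f := by
  induction g using MvPolynomial.induction_on with
  | C d => simp
  | add p q hp hq => rw [map_add, hp, hq, ham_add, Derivation.add_apply]; ring
  | mul_X p i hp => rw [Derivation.leibniz, hp, ham_mul]; simp; ring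

theorem ham_self (f : S.Poly) : S.ham f f = 0 := by
  induction f using MvPolynomial.induction_on with
  | C d => simp [bracket_self]
  | add p q hp hq =>
    rw [ham_add, map_add, Derivation.add_apply, Derivation.add_apply, hp, hq, S.ham_skew p q]; ring
  | mul_X p i hp =>
    have hX : S.hamX i (X i) = 0 := by rcases i with i | i <;> simp
    have h := S.ham_skew p (X i)
    simp only [ham_apply_X, ham_X] at h
    simp [ham_mul, hp, hX]
    ring

/-- The Jacobiator of the bracket on `D[X, Y]`. -/
def jac (f g h : S.Poly) : S.Poly :=
  S.ham (S.ham f g) h - (S.ham f (S.ham g h) - S.ham g (S.ham f h))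

theorem jac_cyc (f g h : S.Poly) : S.jac f g h = S.jac g h f := by
  have h1 := S.ham_skew (S.ham g h) f
  have h2 : S.ham g (S.ham h f) = -S.ham g (S.ham f h) := by
    rw [← map_neg, ← S.ham_skew]
  have h3 : S.ham h (S.ham g f) = S.ham (S.ham f g) h := by
    rw [S.ham_skew g f, map_neg, ← S.ham_skew]
  simp only [jac, h1, h2, h3]
  ring

theorem jac_ext (f g : S.Poly) (hC : ∀ d, S.jac f g (C d) = 0) (hX : ∀ s, S.jac f g (X s) = 0)
    (h : S.Poly) : S.jac f g h = 0 := by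
  have key : S.ham (S.ham f g) = ⁅S.ham f, S.ham g⁆ :=
    der_eqOn
      (fun d => by rw [Derivation.commutator_apply]; exact sub_eq_zero.mp (hC d))
      (fun s => by rw [Derivation.commutator_apply]; exact sub_eq_zero.mp (hX s))
  rw [jac, key, Derivation.commutator_apply, sub_self]

theorem jac_CCC (d e c : D) : S.jac (C d) (C e) (C c) = 0 := by
  have h := jacobi (K := K) d e c
  have h1 := pbr_skew K (pbr K d e) c
  have h2 : pbr K e (pbr K c d) = - pbr K e (pbr K d c) := by
    rw [pbr_skew K c d, pbr, map_neg]
  have h3 : pbr K (pbr K d e) c = pbr K d (pbr K e c) - pbr K e (pbr K d c) := by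
    simp only [pbr] at *
    rw [h1]; linear_combination h2 - h
  simp [jac, h3]

theorem jac_CCX (d e : D) (s) : S.jac (C d) (C e) (X s) = 0 := by
  rcases s with i | i <;> simp [jac, S.der_poisson i d e] <;> rw [pbr_skew K (S.der i d) e] <;>
    simp <;> ring

theorem jac_CXX (d : D) (s t) : S.jac (C d) (X s) (X t) = 0 := by
  rcases s with i | i <;> rcases t with j | j <;> simp [jac]
  · rw [S.der_comm]; ring
  · by_cases h : i = j
    · subst h; simp [S.der_pbr_a]; ring
    · simp [h, Ne.symm h]; rw [S.der_comm]; ring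
  · by_cases h : i = j
    · subst h; simp [S.der_pbr_a]; ring
    · simp [h, Ne.symm h]; rw [S.der_comm]; ring
  · rw [S.der_comm]; ring

theorem jac_XXX (s t u) : S.jac (X s) (X t) (X u) = 0 := by
  rcases s with i | i <;> rcases t with j | j <;> rcases u with k | k <;> simp [jac] <;>
  split_ifs <;> simp_all [S.der_der_a, der_der_a']

theorem jac_eq_zero (f g h : S.Poly) : S.jac f g h = 0 := by
  have hXX (s t) : ∀ h, S.jac (X s) (X t) h = 0 :=
    S.jac_ext _ _ (fun d => by rw [← jac_cyc]; exact S.jac_CXX d s t) (S.jac_XXX s t)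
  have hCC (d e) : ∀ h, S.jac (C d) (C e) h = 0 :=
    S.jac_ext _ _ (S.jac_CCC d e) (S.jac_CCX d e)
  have hCX (d s) : ∀ h, S.jac (C d) (X s) h = 0 :=
    S.jac_ext _ _ (fun e => by rw [← jac_cyc]; exact S.jac_CCX e d s) (S.jac_CXX d s)
  have hXC (s d) : ∀ h, S.jac (X s) (C d) h = 0 :=
    S.jac_ext _ _ (fun e => by rw [jac_cyc]; exact S.jac_CCX d e s)
      (fun t => by rw [jac_cyc]; exact S.jac_CXX d t s)
  have hC (d f g) : S.jac f (C d) g = 0 :=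
    S.jac_ext _ _ (fun e => by rw [jac_cyc]; exact hCC d e f)
      (fun s => by rw [jac_cyc]; exact hCX d s f) g
  have hX (s f g) : S.jac f (X s) g = 0 :=
    S.jac_ext _ _ (fun e => by rw [jac_cyc]; exact hXC s e f)
      (fun t => by rw [jac_cyc]; exact hXX s t f) g
  exact S.jac_ext _ _ (fun d => by rw [jac_cyc]; exact hC d g f)
    (fun s => by rw [jac_cyc]; exact hX s g f) h

theorem ham_jacobi (f g h : S.Poly) :
    S.ham f (S.ham g h) + S.ham g (S.ham h f) + S.ham h (S.ham f g) = 0 := by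
  have h0 := S.jac_eq_zero f g h
  have h1 := S.ham_skew (S.ham f g) h
  have h2 : S.ham g (S.ham h f) = -S.ham g (S.ham f h) := by
    rw [← map_neg, ← S.ham_skew]
  rw [jac, h1] at h0
  rw [h2]
  linear_combination -h0

/-- The element `X_i Y_i - a_i` of `D[X, Y]`. -/
def rel (i : Fin n) : S.Poly := S.pX i * S.pY i - C (S.a i)

/-- The ideal `(X_1 Y_1 - a_1, …, X_n Y_n - a_n)` of `D[X, Y]`. -/
def relIdeal : Ideal S.Poly := Ideal.span (Set.range S.rel)

theorem ham_neg (f : S.Poly) : S.ham (-f) = -S.ham f := by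
  refine Derivation.ext fun g => ?_
  rw [ham_skew, map_neg, neg_neg, Derivation.neg_apply, S.ham_skew f g, neg_neg]

theorem ham_rel (i : Fin n) : S.ham (S.rel i) = 0 := by
  rw [rel, sub_eq_add_neg, ham_add, ham_neg, ham_mul]
  refine der_eqOn (fun d => ?_) ?_
  · have h : pbr K (S.a i) d = 0 := S.a_mem i d
    simp [h]; ring
  · rintro (j | j) <;> by_cases h : i = j
    · subst h; simp; ring
    · simp [h, S.der_a j i (Ne.symm h)]
    · subst h; simp; ring
    · simp [h, S.der_a j i (Ne.symm h)]

theorem ham_mem_relIdeal (f : S.Poly) {g : S.Poly} (hg : g ∈ S.relIdeal) :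
    S.ham f g ∈ S.relIdeal := by
  refine Submodule.span_induction ?_ ?_ ?_ ?_ hg
  · rintro _ ⟨i, rfl⟩
    rw [ham_skew, ham_rel]
    simp
  · simp
  · intro x y _ _ hx hy
    rw [map_add]
    exact Ideal.add_mem _ hx hy
  · intro p x hx hx'
    rw [smul_eq_mul, Derivation.leibniz]
    exact Ideal.add_mem _ (Ideal.mul_mem_left _ _ hx') (Ideal.mul_mem_right _ _ hx)

end GWPAData

section GWPA

variable {K D : Type*} [CommRing K] [CommRing D] [Algebra K D] [PoissonAlgebra K D] {n : ℕ}
variable (S : GWPAData K D n)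

/-- The generalized Weyl Poisson algebra `A = D[X, Y; a, ∂}`: as an associative algebra it is the
commutative generalized Weyl algebra `D[X, Y] / (X_1 Y_1 - a_1, …, X_n Y_n - a_n)`. -/
def GWPA := S.Poly ⧸ S.relIdeal

namespace GWPA

instance : CommRing (GWPA S) := inferInstanceAs (CommRing (S.Poly ⧸ S.relIdeal))

instance : Algebra K (GWPA S) := inferInstanceAs (Algebra K (S.Poly ⧸ S.relIdeal))

/-- The quotient map `D[X, Y] → A`. -/
def mk : S.Poly →ₐ[K] GWPA S := Ideal.Quotient.mkₐ K S.relIdeal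

theorem mk_surjective : Function.Surjective (mk S) := Ideal.Quotient.mkₐ_surjective K S.relIdeal

/-- The Poisson bracket of `A`, induced by that of `D[X, Y]`. -/
def br : GWPA S → GWPA S → GWPA S :=
  Quotient.map₂ (fun f g => S.ham f g) (by
    intro f f' hf g g' hg
    replace hf := (Submodule.quotientRel_def _).mp hf
    replace hg := (Submodule.quotientRel_def _).mp hg
    refine (Submodule.quotientRel_def _).mpr ?_
    have h1 := S.ham_mem_relIdeal f hg
    have h2 := S.ham_mem_relIdeal g' hf
    have h3 : S.ham f g - S.ham f' g' = S.ham f (g - g') - S.ham g' (f - f') := by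
      rw [map_sub, map_sub, S.ham_skew g' f, S.ham_skew g' f']
      ring
    rw [h3]
    exact Ideal.sub_mem _ h1 h2)

theorem br_mk (f g : S.Poly) : br S (mk S f) (mk S g) = mk S (S.ham f g) := rfl

instance : PoissonAlgebra K (GWPA S) where
  bracket := LinearMap.mk₂ K (br S)
    (fun x y z => by
      obtain ⟨x, rfl⟩ := mk_surjective S x
      obtain ⟨y, rfl⟩ := mk_surjective S y
      obtain ⟨z, rfl⟩ := mk_surjective S z
      rw [← map_add, br_mk, br_mk, br_mk, ← map_add, S.ham_add, Derivation.add_apply])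
    (fun r x y => by
      obtain ⟨x, rfl⟩ := mk_surjective S x
      obtain ⟨y, rfl⟩ := mk_surjective S y
      rw [← map_smul, br_mk, br_mk, ← map_smul, S.ham_smul, Derivation.smul_apply])
    (fun x y z => by
      obtain ⟨x, rfl⟩ := mk_surjective S x
      obtain ⟨y, rfl⟩ := mk_surjective S y
      obtain ⟨z, rfl⟩ := mk_surjective S z
      rw [← map_add, br_mk, br_mk, br_mk, ← map_add, map_add])
    (fun r x y => by
      obtain ⟨x, rfl⟩ := mk_surjective S x
      obtain ⟨y, rfl⟩ := mk_surjective S y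
      rw [← map_smul, br_mk, br_mk, ← map_smul, Derivation.map_smul])
  bracket_self x := by
    obtain ⟨x, rfl⟩ := mk_surjective S x
    rw [LinearMap.mk₂_apply, br_mk, S.ham_self, map_zero]
  jacobi x y z := by
    obtain ⟨x, rfl⟩ := mk_surjective S x
    obtain ⟨y, rfl⟩ := mk_surjective S y
    obtain ⟨z, rfl⟩ := mk_surjective S z
    simp only [LinearMap.mk₂_apply, br_mk]
    rw [← map_add, ← map_add, S.ham_jacobi, map_zero]
  leibniz x y z := by
    obtain ⟨x, rfl⟩ := mk_surjective S x
    obtain ⟨y, rfl⟩ := mk_surjective S y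
    obtain ⟨z, rfl⟩ := mk_surjective S z
    simp only [LinearMap.mk₂_apply, br_mk, ← map_mul]
    rw [← map_add, Derivation.leibniz, smul_eq_mul, smul_eq_mul, add_comm, mul_comm z]

/-- The image of `d ∈ D` in `A`. -/
def ofD (d : D) : GWPA S := mk S (C d)
/-- The generator `X_i` of `A`. -/
def x (i : Fin n) : GWPA S := mk S (S.pX i)
/-- The generator `Y_i` of `A`. -/
def y (i : Fin n) : GWPA S := mk S (S.pY i)

theorem pbr_mk (f g : S.Poly) : pbr K (mk S f) (mk S g) = mk S (S.ham f g) := rfl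

theorem x_mul_y (i : Fin n) : x S i * y S i = ofD S (S.a i) :=
  (Ideal.Quotient.eq (I := S.relIdeal)).mpr (Ideal.subset_span ⟨i, rfl⟩)

/-! The bracket of `A` extends the bracket of `D` and is given by the rules that define the
generalized Weyl Poisson algebra. -/

theorem pbr_ofD (d e : D) : pbr K (ofD S d) (ofD S e) = ofD S (pbr K d e) := by
  simp [ofD, pbr_mk]

theorem pbr_y_ofD (i : Fin n) (d : D) :
    pbr K (y S i) (ofD S d) = ofD S (S.der i d) * y S i := by
  simp [ofD, y, pbr_mk]

theorem pbr_x_ofD (i : Fin n) (d : D) :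
    pbr K (x S i) (ofD S d) = -(ofD S (S.der i d) * x S i) := by
  simp [ofD, x, pbr_mk]

theorem pbr_y_x (i j : Fin n) :
    pbr K (y S i) (x S j) = if i = j then ofD S (S.der i (S.a i)) else 0 := by
  simp only [ofD, x, y, pbr_mk, S.ham_X, S.hamX_Y_X]
  split_ifs <;> simp

theorem pbr_x_x (i j : Fin n) : pbr K (x S i) (x S j) = 0 := by
  simp [x, pbr_mk]

theorem pbr_y_y (i j : Fin n) : pbr K (y S i) (y S j) = 0 := by
  simp [y, pbr_mk]

end GWPA

end GWPA

/-- An ideal `I` of `D` is `∂`-invariant if `∂_i(I) ⊆ I` for all `i`. -/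
def IsDerInvariant {K D : Type*} [CommRing K] [CommRing D] [Algebra K D] {n : ℕ}
    (der : Fin n → Derivation K D D) (I : Ideal D) : Prop :=
  ∀ i, ∀ d ∈ I, der i d ∈ I

end

/-! The proof separates the enveloping algebra from the generalized Weyl structure. For any Poisson
algebra `P`, `𝒰(P)` is simple exactly when `P` is Poisson simple and faithful
(`PoissonEnv.isSimpleRing_iff`). Annihilators of the modules `P ⧸ I` are two-sided ideals, which
gives one direction. For the other, elements of `𝒰(P)` behave like differential operators:
commutators with `P` lower the order, so a nonzero two-sided ideal meets the image of `P`
nontrivially, and its contraction to `P` is a nonzero Poisson ideal. What remains is that, for `A`,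
Poisson simplicity is equivalent to (a), (b), (c).

If `A` is Poisson simple, then (a) follows by extending ideals of `D` to `A`, (b) from the Poisson
ideal generated by `X_i`, `Y_i`, `∂_i(a_i)`, and (c) because a nonzero central element generates a
Poisson ideal.

Conversely, (c) is used through evaluations: a central element taking every nonzero value in some
infinite field contradicts it (`GWPA.not_isField_center`). Applied to `X_j ^ m`, this makes positive
integers invertible as soon as there is an index `j`; with (a) and (b) each `a_i` is then regular.
Hence a nonzero Poisson ideal `J`, after multiplication by powers of `X_1 ⋯ X_n`, contains
polynomials in the `X_i` with nonzero coefficient families. A family of minimal support, normalized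
by (a), has semi-invariant coefficients (`GWPA.exists_semiinvariant`). A second nonzero coefficient
would produce a nonconstant Laurent-type central monomial, which (c) forbids
(`GWPA.semiinvariant_eq_zero`). So `J` contains a monomial, and bracketing with the `Y_i` lowers it
to `1` by (b). -/

open PoissonAlgebra

/-! ### Simplicity of the Poisson enveloping algebra -/

namespace PoissonEnv

variable (K : Type*) {P : Type*} [CommRing K] [CommRing P] [Algebra K P] [PoissonAlgebra K P]

/-- The projection from the free algebra onto the Poisson enveloping algebra. -/
def proj : Free K P →ₐ[K] PoissonEnv K P := RingQuot.mkAlgHom K (Rel K P)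

theorem proj_surjective : Function.Surjective (proj K (P := P)) :=
  RingQuot.mkAlgHom_surjective K (Rel K P)

theorem proj_rel {u v : Free K P} (h : Rel K P u v) : proj K u = proj K v :=
  RingQuot.mkAlgHom_rel K h

/-- The image of `p ∈ P` in the enveloping algebra. -/
def of (p : P) : PoissonEnv K P := proj K (coe K p)

/-- The element `δ_p` of the enveloping algebra. -/
def delta (p : P) : PoissonEnv K P := proj K (del K p)

theorem of_add (p q : P) : of K (p + q) = of K p + of K q := by
  rw [of, proj_rel K (Rel.coe_add p q), map_add]; rfl

theorem of_mul (p q : P) : of K (p * q) = of K p * of K q := by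
  rw [of, proj_rel K (Rel.coe_mul p q), map_mul]; rfl

theorem of_one : of K (1 : P) = 1 := by
  have h := proj_rel K (Rel.coe_algebraMap (A := P) (1 : K))
  rwa [map_one, map_one, map_one] at h

theorem of_zero : of K (0 : P) = 0 := by
  simpa using of_add K (0 : P) 0

theorem of_pbr (p q : P) : of K (pbr K p q) = delta K p * of K q - of K q * delta K p := by
  rw [of, proj_rel K (Rel.del_coe p q), map_sub, map_mul, map_mul]; rfl

theorem rep_proj (u : Free K P) : rep K P (proj K u) = FreeAlgebra.lift K
    (Sum.elim (fun a => LinearMap.mulLeft K a) (fun a => bracket (K := K) a)) u :=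
  RingQuot.liftAlgHom_mkAlgHom_apply K _ _ u

@[simp] theorem rep_of (p q : P) : rep K P (of K p) q = p * q := by
  rw [of, rep_proj]; simp

@[simp] theorem rep_delta (p q : P) : rep K P (delta K p) q = pbr K p q := by
  rw [delta, rep_proj]; simp

theorem smul_eq_rep (u : PoissonEnv K P) (p : P) : u • p = rep K P u p := rfl

variable {K}

theorem induction {C : PoissonEnv K P → Prop} (halg : ∀ r, C (algebraMap K _ r))
    (hof : ∀ p, C (of K p)) (hdelta : ∀ p, C (delta K p))
    (hmul : ∀ u v, C u → C v → C (u * v)) (hadd : ∀ u v, C u → C v → C (u + v))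
    (u : PoissonEnv K P) : C u := by
  obtain ⟨u, rfl⟩ := proj_surjective K u
  induction u using FreeAlgebra.induction with
  | grade0 r => rw [AlgHom.commutes]; exact halg r
  | grade1 x => rcases x with p | p; exacts [hof p, hdelta p]
  | mul u v hu hv => rw [map_mul]; exact hmul _ _ hu hv
  | add u v hu hv => rw [map_add]; exact hadd _ _ hu hv

theorem algebraMap_eq_of (r : K) : algebraMap K (PoissonEnv K P) r = of K (algebraMap K P r) := by
  rw [of, proj_rel K (Rel.coe_algebraMap r), AlgHom.commutes]

theorem rep_mem_of_isPoissonIdeal {I : Ideal P} (hI : IsPoissonIdeal K I) (u : PoissonEnv K P) :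
    ∀ p ∈ I, rep K P u p ∈ I := by
  induction u using induction with
  | halg r => intro p hp; rw [algebraMap_eq_of, rep_of]; exact I.mul_mem_left _ hp
  | hof q => intro p hp; rw [rep_of]; exact I.mul_mem_left _ hp
  | hdelta q => intro p hp; rw [rep_delta]; exact hI q p hp
  | hmul u v hu hv => intro p hp; rw [map_mul]; exact hu _ (hv p hp)
  | hadd u v hu hv => intro p hp; rw [map_add]; exact I.add_mem (hu p hp) (hv p hp)

/-- The annihilator of `P ⧸ I` in the enveloping algebra, for a Poisson ideal `I`. -/
def quotientAnnihilator {I : Ideal P} (hI : IsPoissonIdeal K I) :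
    TwoSidedIdeal (PoissonEnv K P) :=
  TwoSidedIdeal.mk' {u | ∀ p, rep K P u p ∈ I}
    (fun p => by simp)
    (fun {u v} hu hv p => by rw [map_add]; exact I.add_mem (hu p) (hv p))
    (fun {u} hu p => by rw [map_neg]; exact I.neg_mem (hu p))
    (fun {u v} hv p => by rw [map_mul]; exact rep_mem_of_isPoissonIdeal hI u _ (hv p))
    (fun {u v} hu p => by rw [map_mul]; exact hu _)

theorem mem_quotientAnnihilator {I : Ideal P} (hI : IsPoissonIdeal K I) (u : PoissonEnv K P) :
    u ∈ quotientAnnihilator hI ↔ ∀ p, rep K P u p ∈ I := by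
  rw [quotientAnnihilator, TwoSidedIdeal.mem_mk']; rfl

/-- The identity acts as the identity, so it annihilates `P ⧸ I` only when `1 ∈ I`; simplicity
leaves the zero ideal. -/
theorem quotientAnnihilator_eq_bot [IsSimpleRing (PoissonEnv K P)] {I : Ideal P}
    (hI : IsPoissonIdeal K I) (h : I ≠ ⊤) : quotientAnnihilator hI = ⊥ := by
  refine (eq_bot_or_eq_top _).resolve_right fun ht => h ?_
  have h1 : (1 : PoissonEnv K P) ∈ quotientAnnihilator hI := ht ▸ TwoSidedIdeal.mem_top _
  rw [mem_quotientAnnihilator] at h1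
  simpa [Ideal.eq_top_iff_one] using h1 1

theorem nontrivial_of_isSimpleRing [IsSimpleRing (PoissonEnv K P)] : Nontrivial P := by
  by_contra h
  rw [not_nontrivial_iff_subsingleton] at h
  exact one_ne_zero ((of_one K).symm.trans ((congrArg _ (Subsingleton.elim (1 : P) 0)).trans
    (of_zero K)))

/-! ### Order of elements, as for differential operators -/

/-- `HasOrder m u`: all `m`-fold commutators of `u` with elements of `P` vanish. -/
def HasOrder : ℕ → PoissonEnv K P → Prop
  | 0, u => u = 0
  | m + 1, u => ∀ p, HasOrder m (u * of K p - of K p * u)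

theorem HasOrder.zero (m : ℕ) : HasOrder m (0 : PoissonEnv K P) := by
  induction m with
  | zero => rfl
  | succ m ih => intro p; simpa using ih

theorem HasOrder.succ {m : ℕ} : ∀ {u : PoissonEnv K P}, HasOrder m u → HasOrder (m + 1) u := by
  induction m with
  | zero => rintro u hu p; rw [show u = 0 from hu]; simpa using HasOrder.zero 0
  | succ m ih => exact fun hu p => ih (hu p)

theorem HasOrder.mono {m k : ℕ} (h : m ≤ k) {u : PoissonEnv K P} (hu : HasOrder m u) :
    HasOrder k u := by
  induction h with
  | refl => exact hu
  | step _ ih => exact ih.succ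

theorem HasOrder.add {m : ℕ} : ∀ {u v : PoissonEnv K P}, HasOrder m u → HasOrder m v →
    HasOrder m (u + v) := by
  induction m with
  | zero => intro u v hu hv; rw [show u = 0 from hu, show v = 0 from hv]; exact add_zero _
  | succ m ih =>
    intro u v hu hv p
    have : (u + v) * of K p - of K p * (u + v)
        = (u * of K p - of K p * u) + (v * of K p - of K p * v) := by noncomm_ring
    rw [this]
    exact ih (hu p) (hv p)

/-- The commutator with `p` is a derivation, so each term of `[uv, p]` has one factor of lower
order. The separate bound `s` lets a single induction serve both terms. -/
theorem HasOrder.mul {s : ℕ} : ∀ {m k : ℕ} {u v : PoissonEnv K P}, m + k ≤ s → HasOrder m u →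
    HasOrder k v → HasOrder s (u * v) := by
  induction s with
  | zero =>
    intro m k u v h hu hv
    obtain ⟨rfl, rfl⟩ : m = 0 ∧ k = 0 := by omega
    rw [show u = 0 from hu]; exact zero_mul _
  | succ s ih =>
    intro m k u v h hu hv
    rcases m with _ | m
    · rw [show u = 0 from hu, zero_mul]; exact HasOrder.zero _
    rcases k with _ | k
    · rw [show v = 0 from hv, mul_zero]; exact HasOrder.zero _
    intro p
    have : u * v * of K p - of K p * (u * v)
        = u * (v * of K p - of K p * v) + (u * of K p - of K p * u) * v := by noncomm_ring
    rw [this]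
    exact (ih (by omega) hu (hv p)).add (ih (by omega) (hu p) hv)

theorem hasOrder_of (q : P) : HasOrder 1 (of K q) := fun p => by
  rw [← of_mul, ← of_mul, mul_comm, sub_self]; rfl

/-- Only generators matter: elements of `P` commute with each other, and `[δ_q, p] = {q, p}` lies in
`P` again. -/
theorem exists_hasOrder (u : PoissonEnv K P) : ∃ m, HasOrder m u := by
  induction u using induction with
  | halg r => rw [algebraMap_eq_of]; exact ⟨1, hasOrder_of _⟩
  | hof q => exact ⟨1, hasOrder_of _⟩
  | hdelta q => exact ⟨2, fun p => by rw [← of_pbr]; exact hasOrder_of _⟩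
  | hmul u v hu hv =>
    obtain ⟨m, hm⟩ := hu
    obtain ⟨k, hk⟩ := hv
    exact ⟨m + k, hm.mul le_rfl hk⟩
  | hadd u v hu hv =>
    obtain ⟨m, hm⟩ := hu
    obtain ⟨k, hk⟩ := hv
    exact ⟨max m k, (hm.mono (le_max_left _ _)).add (hk.mono (le_max_right _ _))⟩

/-- Commuting with `P` makes the action of `u` on `P` a `P`-linear map, hence multiplication by its
value at `1`; faithfulness lifts this equality to `𝒰(P)`. -/
theorem eq_of_rep_one [FaithfulSMul (PoissonEnv K P) P] {u : PoissonEnv K P}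
    (hu : ∀ p, u * of K p = of K p * u) : u = of K (rep K P u 1) := by
  refine FaithfulSMul.eq_of_smul_eq_smul (α := P) fun p => ?_
  rw [smul_eq_rep, smul_eq_rep, rep_of]
  have h := congrArg (fun w => rep K P w 1) (hu p)
  simp only [map_mul, Module.End.mul_apply, rep_of, mul_one] at h
  rw [h, mul_comm]

/-- Commutators with `P` stay in `J` and lower the order. The process stops at a nonzero element
commuting with `P`, and such an element comes from `P`. -/
theorem exists_of_mem [FaithfulSMul (PoissonEnv K P) P] (J : TwoSidedIdeal (PoissonEnv K P))
    {m : ℕ} : ∀ {u : PoissonEnv K P}, HasOrder m u → u ∈ J → u ≠ 0 →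
      ∃ p, of K p ∈ J ∧ of K p ≠ 0 := by
  induction m with
  | zero => exact fun hu _ h0 => absurd hu h0
  | succ m ih =>
    intro u hu hJ h0
    by_cases hc : ∀ p, u * of K p - of K p * u = 0
    · have h := eq_of_rep_one fun p => sub_eq_zero.mp (hc p)
      exact ⟨rep K P u 1, h ▸ hJ, h ▸ h0⟩
    · push Not at hc
      obtain ⟨p, hp⟩ := hc
      exact ih (hu p) (J.sub_mem (J.mul_mem_right _ _ hJ) (J.mul_mem_left _ _ hJ)) hp

/-- The Poisson enveloping algebra of `P` is simple if and only if `P` is Poisson simple and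
is a faithful module over it. -/
theorem isSimpleRing_iff : IsSimpleRing (PoissonEnv K P) ↔
    (Nontrivial P ∧ ∀ I : Ideal P, IsPoissonIdeal K I → I = ⊥ ∨ I = ⊤) ∧
      FaithfulSMul (PoissonEnv K P) P := by
  constructor
  · intro hs
    have hP : Nontrivial P := nontrivial_of_isSimpleRing (K := K)
    refine ⟨⟨hP, fun I hI => or_iff_not_imp_right.mpr fun ht => ?_⟩, ⟨fun {u v} huv => ?_⟩⟩
    · have h := quotientAnnihilator_eq_bot hI ht
      refine (Submodule.eq_bot_iff _).mpr fun p hp => ?_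
      have hm : of K p ∈ quotientAnnihilator hI := by
        rw [mem_quotientAnnihilator]
        intro q
        rw [rep_of]
        exact I.mul_mem_right _ hp
      rw [h, TwoSidedIdeal.mem_bot] at hm
      simpa [hm] using (rep_of K p 1).symm
    · have hI : IsPoissonIdeal K (⊥ : Ideal P) := fun x y hy => by
        rw [Ideal.mem_bot] at hy ⊢; rw [hy, pbr, map_zero]
      have h := quotientAnnihilator_eq_bot hI bot_ne_top
      have hm : u - v ∈ quotientAnnihilator hI := by
        rw [mem_quotientAnnihilator]
        intro p
        have := huv p
        rw [smul_eq_rep, smul_eq_rep] at this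
        simp [this]
      rwa [h, TwoSidedIdeal.mem_bot, sub_eq_zero] at hm
  · rintro ⟨⟨hP, hI⟩, hf⟩
    have hnt : Nontrivial (PoissonEnv K P) := ⟨⟨1, 0, fun h => by
      have h1 := congrArg (fun w => rep K P w 1) h
      simp at h1⟩⟩
    refine ⟨⟨fun J => or_iff_not_imp_left.mpr fun hJ => ?_⟩⟩
    obtain ⟨u, huJ, hu0⟩ : ∃ u ∈ J, u ≠ 0 := by
      by_contra! h
      exact hJ (eq_bot_iff.mpr fun u hu => (TwoSidedIdeal.mem_bot _).mpr (h u hu))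
    obtain ⟨m, hm⟩ := exists_hasOrder u
    obtain ⟨p, hpJ, hp0⟩ := exists_of_mem J hm huJ hu0
    -- The contraction of `J` to `P`; it is a Poisson ideal because `{x, q} = [δ_x, q]` in `𝒰(P)`.
    let I : Ideal P :=
      { carrier := {q | of K q ∈ J}
        add_mem' := fun {a b} ha hb => by
          change of K _ ∈ J
          rw [of_add]; exact J.add_mem ha hb
        zero_mem' := by
          change of K _ ∈ J
          rw [of_zero]; exact J.zero_mem
        smul_mem' := fun a b hb => by
          change of K _ ∈ J
          rw [smul_eq_mul, of_mul]; exact J.mul_mem_left _ _ hb }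
    have hIP : IsPoissonIdeal K I := fun x q (hq : of K q ∈ J) => by
      change of K _ ∈ J
      rw [of_pbr]
      exact J.sub_mem (J.mul_mem_left _ _ hq) (J.mul_mem_right _ _ hq)
    have hI1 : (1 : P) ∈ I := by
      rcases hI I hIP with h | h
      · have : p ∈ I := hpJ
        rw [h, Ideal.mem_bot] at this
        rw [this, of_zero] at hp0
        exact absurd rfl hp0
      · rw [h]; trivial
    have h1 : (1 : PoissonEnv K P) ∈ J := by
      have : of K (1 : P) ∈ J := hI1
      rwa [of_one] at this
    exact eq_top_iff.mpr fun v _ => by simpa using J.mul_mem_left v 1 h1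

end PoissonEnv

/-! ### Brackets with powers and products; the Poisson centre -/

namespace PoissonAlgebra

variable {K P : Type*} [CommRing K] [CommRing P] [Algebra K P] [PoissonAlgebra K P]

theorem pbr_mul_right (x y z : P) : pbr K x (y * z) = pbr K x y * z + y * pbr K x z :=
  leibniz x y z

theorem pbr_add_right (x y z : P) : pbr K x (y + z) = pbr K x y + pbr K x z := map_add _ _ _

theorem pbr_zero_right (x : P) : pbr K x 0 = 0 := map_zero _

theorem pbr_pow_right (x y : P) (m : ℕ) : pbr K x (y ^ m) = m * y ^ (m - 1) * pbr K x y := by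
  have h := (pad K x).leibniz_pow y m
  rwa [nsmul_eq_mul, smul_eq_mul, ← mul_assoc, pad_apply, pad_apply] at h

theorem pbr_one_right (x : P) : pbr K x 1 = 0 := (pad K x).map_one_eq_zero

theorem pbr_pow_of_pbr_eq {x f e : P} (h : pbr K x f = e * f) (m : ℕ) :
    pbr K x (f ^ m) = m * e * f ^ m := by
  rw [pbr_pow_right, h]
  rcases m with _ | m
  · simp
  · rw [Nat.add_sub_cancel, pow_succ]; ring

/-- A derivation acts on a product through the sum of its logarithmic derivatives; no factor needs
to be invertible. -/
theorem pbr_prod_right {ι : Type*} (s : Finset ι) (x : P) (f e : ι → P)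
    (h : ∀ i ∈ s, pbr K x (f i) = e i * f i) :
    pbr K x (∏ i ∈ s, f i) = (∑ i ∈ s, e i) * ∏ i ∈ s, f i := by
  classical
  induction s using Finset.induction_on with
  | empty => rw [Finset.prod_empty, Finset.sum_empty, zero_mul, pbr_one_right]
  | insert i s hi ih =>
    rw [Finset.prod_insert hi, Finset.sum_insert hi, pbr_mul_right,
      ih fun j hj => h j (Finset.mem_insert_of_mem hj), h i (Finset.mem_insert_self i s)]
    ring

theorem pbr_mem_span {s : Set P} {x : P} (h : ∀ t ∈ s, pbr K x t ∈ Ideal.span s) {y : P}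
    (hy : y ∈ Ideal.span s) : pbr K x y ∈ Ideal.span s := by
  induction hy using Submodule.span_induction with
  | mem t ht => exact h t ht
  | zero => rw [pbr_zero_right]; exact Ideal.zero_mem _
  | add u v _ _ hu hv => rw [pbr_add_right]; exact Ideal.add_mem _ hu hv
  | smul r u hu hu' =>
    rw [smul_eq_mul, pbr_mul_right]
    exact Ideal.add_mem _ (Ideal.mul_mem_left _ _ hu) (Ideal.mul_mem_left _ _ hu')

/-- A nonzero central `z` generates a Poisson ideal, hence is a unit. Its inverse `w` is central
since `0 = {zw, u} = z {w, u}`. -/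
theorem isField_center [Nontrivial P]
    (h : ∀ I : Ideal P, IsPoissonIdeal K I → I = ⊥ ∨ I = ⊤) : IsField (center K P) := by
  refine ⟨⟨1, 0, fun h1 => one_ne_zero (congrArg Subtype.val h1)⟩, mul_comm, fun {z} hz => ?_⟩
  obtain ⟨z, hzc⟩ := z
  have hz0 : z ≠ 0 := fun h0 => hz (Subtype.ext h0)
  have hP : IsPoissonIdeal K (Ideal.span {z}) := fun u v hv => by
    refine pbr_mem_span ?_ hv
    rintro _ rfl
    rw [pbr_skew, hzc u, neg_zero]
    exact Ideal.zero_mem _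
  rcases h _ hP with h | h
  · exact absurd (Ideal.span_singleton_eq_bot.mp h) hz0
  · obtain ⟨w, hw⟩ := isUnit_iff_exists_inv.mp (Ideal.span_singleton_eq_top.mp h)
    refine ⟨⟨w, fun u => ?_⟩, Subtype.ext hw⟩
    have h1 : pbr K (z * w) u = 0 := by
      rw [hw, pbr_skew, pbr_one_right, neg_zero]
    rw [pbr_mul_left, hzc u, mul_zero, add_zero] at h1
    calc pbr K w u = (z * w) * pbr K w u := by rw [hw, one_mul]
      _ = w * (z * pbr K w u) := by ring
      _ = 0 := by rw [h1, mul_zero]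

end PoissonAlgebra

/-! ### Generators of `A` and homomorphisms out of it -/

namespace GWPA

variable {K D : Type*} [CommRing K] [CommRing D] [Algebra K D] [PoissonAlgebra K D] {n : ℕ}
variable (S : GWPAData K D n)

/-- The ring homomorphism `D → A`. -/
noncomputable def ofDHom : D →+* GWPA S := (mk S).toRingHom.comp MvPolynomial.C

theorem ofDHom_apply (d : D) : ofDHom S d = ofD S d := rfl

theorem ofD_zero : ofD S (0 : D) = 0 := map_zero (ofDHom S)
theorem ofD_one : ofD S (1 : D) = 1 := map_one (ofDHom S)
theorem ofD_add (d e : D) : ofD S (d + e) = ofD S d + ofD S e := map_add (ofDHom S) d e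
theorem ofD_mul (d e : D) : ofD S (d * e) = ofD S d * ofD S e := map_mul (ofDHom S) d e

theorem pbr_ofD_x (i : Fin n) (d : D) : pbr K (ofD S d) (x S i) = ofD S (S.der i d) * x S i := by
  rw [pbr_skew, pbr_x_ofD, neg_neg]

theorem pbr_ofD_y (i : Fin n) (d : D) :
    pbr K (ofD S d) (y S i) = -(ofD S (S.der i d) * y S i) := by
  rw [pbr_skew, pbr_y_ofD]

theorem pbr_x_y (i j : Fin n) :
    pbr K (x S i) (y S j) = if i = j then -ofD S (S.der i (S.a i)) else 0 := by
  rw [pbr_skew, pbr_y_x]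
  by_cases h : i = j
  · subst h; simp
  · simp [h, Ne.symm h]

variable {S} in
theorem induction {C : GWPA S → Prop} (hD : ∀ d, C (ofD S d))
    (hadd : ∀ u v, C u → C v → C (u + v)) (hx : ∀ u i, C u → C (u * x S i))
    (hy : ∀ u i, C u → C (u * y S i)) (u : GWPA S) : C u := by
  obtain ⟨f, rfl⟩ := mk_surjective S u
  induction f using MvPolynomial.induction_on with
  | C d => exact hD d
  | add p q hp hq => rw [map_add]; exact hadd _ _ hp hq
  | mul_X p i hp =>
    rw [map_mul]
    rcases i with i | i
    · exact hx _ i hp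
    · exact hy _ i hp

variable {S} in
/-- An ideal spanned by `s` is Poisson if the brackets of the generators of `A` with `s`
lie in it. -/
theorem isPoissonIdeal_span {s : Set (GWPA S)}
    (hD : ∀ d, ∀ t ∈ s, pbr K (ofD S d) t ∈ Ideal.span s)
    (hx : ∀ i, ∀ t ∈ s, pbr K (x S i) t ∈ Ideal.span s)
    (hy : ∀ i, ∀ t ∈ s, pbr K (y S i) t ∈ Ideal.span s) :
    IsPoissonIdeal K (Ideal.span s) := by
  intro u
  induction u using induction with
  | hD d => exact fun z hz => pbr_mem_span (hD d) hz
  | hadd u v hu hv =>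
    intro z hz; rw [pbr_add_left]; exact Ideal.add_mem _ (hu z hz) (hv z hz)
  | hx u i hu =>
    intro z hz; rw [pbr_mul_left]
    exact Ideal.add_mem _ (Ideal.mul_mem_left _ _ (pbr_mem_span (hx i) hz))
      (Ideal.mul_mem_left _ _ (hu z hz))
  | hy u i hu =>
    intro z hz; rw [pbr_mul_left]
    exact Ideal.add_mem _ (Ideal.mul_mem_left _ _ (pbr_mem_span (hy i) hz))
      (Ideal.mul_mem_left _ _ (hu z hz))

variable {S} in
/-- An element of `A` is Poisson central if its brackets with the generators vanish. -/
theorem mem_center {z : GWPA S} (hD : ∀ d, pbr K (ofD S d) z = 0)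
    (hx : ∀ i, pbr K (x S i) z = 0) (hy : ∀ i, pbr K (y S i) z = 0) :
    z ∈ center K (GWPA S) := by
  intro u
  rw [pbr_skew, neg_eq_zero]
  induction u using induction with
  | hD d => exact hD d
  | hadd u v hu hv => rw [pbr_add_left, hu, hv, add_zero]
  | hx u i hu => rw [pbr_mul_left, hu, hx, mul_zero, mul_zero, add_zero]
  | hy u i hu => rw [pbr_mul_left, hu, hy, mul_zero, mul_zero, add_zero]

section lift

variable {R : Type*} [CommRing R] (φ : D →+* R) (vx vy : Fin n → R)
  (h : ∀ i, vx i * vy i = φ (S.a i))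

/-- The ring homomorphism out of `A` given by a ring homomorphism on `D` and the images
of the generators. -/
noncomputable def lift : GWPA S →+* R :=
  Ideal.Quotient.lift S.relIdeal (MvPolynomial.eval₂Hom φ (Sum.elim vx vy)) (by
    have : S.relIdeal ≤ RingHom.ker (MvPolynomial.eval₂Hom φ (Sum.elim vx vy)) := by
      refine Ideal.span_le.mpr ?_
      rintro _ ⟨i, rfl⟩
      simp [GWPAData.rel, h]
    exact fun f hf => this hf)

@[simp] theorem lift_ofD (d : D) : lift S φ vx vy h (ofD S d) = φ d :=
  (Ideal.Quotient.lift_mk _ _ _).trans (by simp)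

@[simp] theorem lift_x (i : Fin n) : lift S φ vx vy h (x S i) = vx i :=
  (Ideal.Quotient.lift_mk _ _ _).trans (by simp)

@[simp] theorem lift_y (i : Fin n) : lift S φ vx vy h (y S i) = vy i :=
  (Ideal.Quotient.lift_mk _ _ _).trans (by simp)

end lift

/-- The retraction `A → D` with `X_i ↦ 1` and `Y_i ↦ a_i`. -/
noncomputable def retraction : GWPA S →+* D :=
  lift S (RingHom.id D) (fun _ => 1) S.a (fun _ => one_mul _)

@[simp] theorem retraction_ofD (d : D) : retraction S (ofD S d) = d := lift_ofD ..
@[simp] theorem retraction_x (i : Fin n) : retraction S (x S i) = 1 := lift_x ..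

theorem nontrivial_base [Nontrivial (GWPA S)] : Nontrivial D := by
  by_contra h
  rw [not_nontrivial_iff_subsingleton] at h
  exact one_ne_zero ((ofD_one S).symm.trans ((congrArg _ (Subsingleton.elim (1 : D) 0)).trans
    (ofD_zero S)))

/-! ### Necessity of conditions (a) and (b) -/

variable {S}

/-- The extension of `I` to `A` is Poisson because `I` is Poisson and `∂`-invariant. The retraction
onto `D` recovers `I` from it, so the extension is `0` or `A` only if `I` is `0` or `D`. -/
theorem eq_bot_or_eq_top_of_isPoissonSimple
    (hA : ∀ I : Ideal (GWPA S), IsPoissonIdeal K I → I = ⊥ ∨ I = ⊤) (I : Ideal D)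
    (hI : IsPoissonIdeal K I) (hder : IsDerInvariant S.der I) : I = ⊥ ∨ I = ⊤ := by
  have hmem : ∀ d ∈ I, ofD S d ∈ Ideal.map (ofDHom S) I := fun d hd =>
    Ideal.mem_map_of_mem (ofDHom S) hd
  have hP : IsPoissonIdeal K (Ideal.map (ofDHom S) I) := by
    refine isPoissonIdeal_span ?_ ?_ ?_
    · rintro d _ ⟨e, he, rfl⟩
      rw [ofDHom_apply, pbr_ofD]
      exact hmem _ (hI d e he)
    · rintro i _ ⟨e, he, rfl⟩
      rw [ofDHom_apply, pbr_x_ofD]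
      exact Ideal.neg_mem_iff _ |>.mpr (Ideal.mul_mem_right _ _ (hmem _ (hder i e he)))
    · rintro i _ ⟨e, he, rfl⟩
      rw [ofDHom_apply, pbr_y_ofD]
      exact Ideal.mul_mem_right _ _ (hmem _ (hder i e he))
  rcases hA _ hP with h | h
  · left
    refine (Submodule.eq_bot_iff _).mpr fun d hd => ?_
    have := hmem d hd
    rw [h, Ideal.mem_bot] at this
    simpa [this] using (retraction_ofD S d).symm
  · right
    have hle : Ideal.map (ofDHom S) I ≤ Ideal.comap (retraction S) I := by
      refine Ideal.map_le_iff_le_comap.mpr fun d hd => ?_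
      simpa [ofDHom_apply] using hd
    rw [Ideal.eq_top_iff_one]
    have h1 : (1 : GWPA S) ∈ Ideal.comap (retraction S) I := hle (h ▸ Submodule.mem_top)
    simpa using h1

/-- The elements `X_i`, `Y_i`, `∂_i(a_i)` generate a Poisson ideal, nonzero because `X_i ≠ 0`. If
`a_i` and `∂_i(a_i)` generated a proper ideal of `D`, a homomorphism to the quotient would show the
ideal of `A` to be proper too. -/
theorem sup_eq_top_of_isPoissonSimple [Nontrivial (GWPA S)]
    (hA : ∀ I : Ideal (GWPA S), IsPoissonIdeal K I → I = ⊥ ∨ I = ⊤) (i : Fin n) :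
    Ideal.span {S.a i} ⊔ Ideal.span {S.der i (S.a i)} = ⊤ := by
  have hD : Nontrivial D := nontrivial_base S
  by_contra hne
  let s : Set (GWPA S) := {x S i, y S i, ofD S (S.der i (S.a i))}
  have hx : x S i ∈ Ideal.span s := Ideal.subset_span (by simp [s])
  have hy : y S i ∈ Ideal.span s := Ideal.subset_span (by simp [s])
  have ha : ofD S (S.der i (S.a i)) ∈ Ideal.span s := Ideal.subset_span (by simp [s])
  have hP : IsPoissonIdeal K (Ideal.span s) := by
    refine isPoissonIdeal_span ?_ ?_ ?_
    · rintro d _ (rfl | rfl | rfl)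
      · rw [pbr_ofD_x]; exact Ideal.mul_mem_left _ _ hx
      · rw [pbr_ofD_y]; exact Ideal.neg_mem_iff _ |>.mpr (Ideal.mul_mem_left _ _ hy)
      · rw [pbr_ofD, S.der_pbr_a, ofD_zero]; exact Ideal.zero_mem _
    · rintro j _ (rfl | rfl | rfl)
      · rw [pbr_x_x]; exact Ideal.zero_mem _
      · rw [pbr_x_y]
        split_ifs with h
        · subst h; exact Ideal.neg_mem_iff _ |>.mpr ha
        · exact Ideal.zero_mem _
      · rw [pbr_x_ofD]
        by_cases h : j = i
        · subst h; exact Ideal.neg_mem_iff _ |>.mpr (Ideal.mul_mem_left _ _ hx)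
        · rw [S.der_der_a i j (Ne.symm h), ofD_zero, zero_mul, neg_zero]; exact Ideal.zero_mem _
    · rintro j _ (rfl | rfl | rfl)
      · rw [pbr_y_x]
        split_ifs with h
        · subst h; exact ha
        · exact Ideal.zero_mem _
      · rw [pbr_y_y]; exact Ideal.zero_mem _
      · rw [pbr_y_ofD]
        by_cases h : j = i
        · subst h; exact Ideal.mul_mem_left _ _ hy
        · rw [S.der_der_a i j (Ne.symm h), ofD_zero, zero_mul]; exact Ideal.zero_mem _
  rcases hA _ hP with h | h
  · rw [h, Ideal.mem_bot] at hx
    simpa [hx] using retraction_x S i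
  · set J := Ideal.span {S.a i} ⊔ Ideal.span {S.der i (S.a i)} with hJ
    have haJ : S.a i ∈ J := Ideal.mem_sup_left (Ideal.mem_span_singleton_self _)
    have hdJ : S.der i (S.a i) ∈ J := Ideal.mem_sup_right (Ideal.mem_span_singleton_self _)
    -- Sending both `X_i` and `Y_i` to `0` respects `X_i Y_i = a_i` because `a_i ∈ J`; the other
    -- pairs go to `1` and `a_j`.
    let φ : GWPA S →+* D ⧸ J := lift S (Ideal.Quotient.mk J) (fun j => if j = i then 0 else 1)
      (fun j => if j = i then 0 else Ideal.Quotient.mk J (S.a j)) (fun j => by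
        by_cases hj : j = i
        · subst hj; simpa using (Ideal.Quotient.eq_zero_iff_mem.mpr haJ).symm
        · simp [hj])
    have hle : Ideal.span s ≤ RingHom.ker φ := by
      refine Ideal.span_le.mpr ?_
      rintro _ (rfl | rfl | rfl)
      · simp [φ]
      · simp [φ]
      · simpa [φ] using Ideal.Quotient.eq_zero_iff_mem.mpr hdJ
    have h1 : (1 : GWPA S) ∈ RingHom.ker φ := hle (h ▸ Submodule.mem_top)
    rw [RingHom.mem_ker, map_one, ← map_one (Ideal.Quotient.mk J),
      Ideal.Quotient.eq_zero_iff_mem, ← Ideal.eq_top_iff_one] at h1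
    exact hne h1

end GWPA

/-! ### Sufficiency: Poisson simplicity of `A` from (a), (b), (c) -/

namespace GWPA

variable {K D : Type*} [Field K] [CommRing D] [Algebra K D] [PoissonAlgebra K D] {n : ℕ}
variable (S : GWPAData K D n)

/-! ### Evaluations and the Poisson centre -/

variable {S} in
/-- A Poisson central element that takes all nonzero values under homomorphisms to an infinite
field prevents the Poisson centre from being a field. -/
theorem not_isField_center {L : Type*} [Field L] [Infinite L] {z : GWPA S}
    (hz : z ∈ center K (GWPA S)) (hψ : ∀ w : L, w ≠ 0 → ∃ ψ : GWPA S →+* L, ψ z = w) :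
    ¬ IsField (center K (GWPA S)) := by
  intro hF
  -- Either `z = -1` is constant, against its taking a further value, or `1 + z` is invertible
  -- although the evaluation with `z ↦ -1` kills it.
  by_cases h0 : 1 + z = 0
  · classical
    obtain ⟨w, hw⟩ := Infinite.exists_notMem_finset ({0, -1} : Finset L)
    simp only [Finset.mem_insert, Finset.mem_singleton, not_or] at hw
    obtain ⟨ψ, h⟩ := hψ w hw.1
    have h1 := congrArg ψ h0
    rw [map_add, map_one, map_zero, h, add_comm] at h1
    exact hw.2 (eq_neg_of_add_eq_zero_left h1)
  · obtain ⟨ψ, h⟩ := hψ (-1) (neg_ne_zero.mpr one_ne_zero)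
    obtain ⟨w, hw⟩ := hF.mul_inv_cancel
      (a := (⟨1 + z, (center K (GWPA S)).add_mem (one_mem _) hz⟩ : center K (GWPA S)))
      (fun h1 => h0 (congrArg Subtype.val h1))
    have h1 := congrArg ψ (congrArg Subtype.val hw)
    change ψ ((1 + z) * w) = ψ 1 at h1
    rw [map_mul, map_add, map_one, h, add_neg_cancel, zero_mul] at h1
    exact zero_ne_one h1

/-- The evaluation `A → L` with `X_j ↦ s`, `Y_j ↦ a_j / s`, and `X_i ↦ 1`, `Y_i ↦ a_i`
for `i ≠ j`. -/
noncomputable def evalAt {L : Type*} [Field L] (q : D →+* L) (j : Fin n) {s : L} (hs : s ≠ 0) :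
    GWPA S →+* L :=
  lift S q (fun i => if i = j then s else 1) (fun i => q (S.a i) * (if i = j then s else 1)⁻¹)
    (fun i => by
      split_ifs
      · field_simp
      · simp)

/-- Algebraic closedness supplies both an infinite target and the roots needed to make a monomial
take a prescribed value. -/
theorem exists_hom_to_isAlgClosed.{u} (D : Type u) [CommRing D] [Nontrivial D] :
    ∃ (L : Type u) (_ : Field L) (_ : IsAlgClosed L), Nonempty (D →+* L) := by
  obtain ⟨m, hm⟩ := Ideal.exists_maximal D
  let _ := Ideal.Quotient.field m
  exact ⟨AlgebraicClosure (D ⧸ m), inferInstance, inferInstance,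
    ⟨(algebraMap (D ⧸ m) _).comp (Ideal.Quotient.mk m)⟩⟩

variable {S}

/-- If `m = 0` in `K`, the Leibniz rule makes `X_j ^ m` central, yet evaluations give it every
nonzero value. The index `j` is essential: in rank zero the characteristic is unrestricted. -/
theorem natCast_ne_zero_of_isField_center (hF : IsField (center K (GWPA S))) (j : Fin n) {m : ℕ}
    (hm : m ≠ 0) : (m : K) ≠ 0 := by
  intro h0
  have : Nontrivial (GWPA S) := by
    obtain ⟨u, v, huv⟩ := hF.exists_pair_ne
    exact ⟨u, v, fun h => huv (Subtype.ext h)⟩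
  have := nontrivial_base S
  obtain ⟨L, _, _, ⟨q⟩⟩ := exists_hom_to_isAlgClosed D
  have hm0 : (m : GWPA S) = 0 := by rw [← map_natCast (algebraMap K (GWPA S)), h0, map_zero]
  have hpow : ∀ u : GWPA S, pbr K u (x S j ^ m) = 0 := fun u => by
    rw [pbr_pow_right, hm0, zero_mul, zero_mul]
  have := IsAlgClosed.instInfinite (K := L)
  refine not_isField_center (L := L)
    (mem_center (fun d => hpow _) (fun i => hpow _) (fun i => hpow _)) (fun w hw => ?_) hF
  obtain ⟨s, hs⟩ := IsAlgClosed.exists_pow_nat_eq w (Nat.pos_of_ne_zero hm)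
  have hs0 : s ≠ 0 := fun h => hw (by rw [← hs, h, zero_pow hm])
  exact ⟨evalAt S q j hs0, by simp [evalAt, hs]⟩

theorem isUnit_natCast (hF : IsField (center K (GWPA S))) (j : Fin n) {m : ℕ} (hm : m ≠ 0) :
    IsUnit (m : D) := by
  rw [← map_natCast (algebraMap K D)]
  exact (IsUnit.mk0 _ (natCast_ne_zero_of_isField_center hF j hm)).map _

theorem isUnit_natCast_sub (hF : IsField (center K (GWPA S))) (j : Fin n) {p q : ℕ} (h : p ≠ q) :
    IsUnit ((p : D) - q) := by
  rcases le_total p q with hpq | hpq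
  · rw [← neg_sub, ← Nat.cast_sub hpq]
    exact (isUnit_natCast hF j (by omega)).neg
  · rw [← Nat.cast_sub hpq]
    exact isUnit_natCast hF j (by omega)

/-! ### Regularity of the defining elements -/

/-- The elements killed by a power of `a_i` form an invariant Poisson ideal, so by (a) it is `0`
unless `a_i` is nilpotent. Differentiating `a_i ^ (l + 1) = 0` gives `a_i ^ l ∂_i(a_i) = 0`, and (b)
then yields `a_i ^ l = 0`; descent ends at `1 = 0`. -/
theorem eq_zero_of_a_pow_mul_eq_zero
    (hD : ∀ I : Ideal D, IsPoissonIdeal K I → IsDerInvariant S.der I → I = ⊥ ∨ I = ⊤)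
    (ha : ∀ i, Ideal.span {S.a i} ⊔ Ideal.span {S.der i (S.a i)} = ⊤)
    (hF : IsField (center K (GWPA S))) [Nontrivial D] (i : Fin n) {k : ℕ} {d : D}
    (h : S.a i ^ k * d = 0) : d = 0 := by
  have hpa : ∀ e k, pbr K e (S.a i ^ k) = 0 := fun e k => by
    rw [pbr_pow_right, S.pbr_a, mul_zero]
  let I : Ideal D :=
    { carrier := {d | ∃ k, S.a i ^ k * d = 0}
      add_mem' := by
        rintro u v ⟨k, hk⟩ ⟨l, hl⟩
        refine ⟨k + l, ?_⟩
        rw [pow_add]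
        linear_combination S.a i ^ l * hk + S.a i ^ k * hl
      zero_mem' := ⟨0, by simp⟩
      smul_mem' := by
        rintro c u ⟨k, hk⟩
        refine ⟨k, ?_⟩
        rw [smul_eq_mul]
        linear_combination c * hk }
  have hmem : ∀ d, d ∈ I ↔ ∃ k, S.a i ^ k * d = 0 := fun _ => Iff.rfl
  have hIP : IsPoissonIdeal K I := by
    rintro e u ⟨k, hk⟩
    refine ⟨k, ?_⟩
    have h1 := congrArg (pbr K e) hk
    rw [pbr_mul_right, hpa, pbr_zero_right, zero_mul, zero_add] at h1
    exact h1
  have hID : IsDerInvariant S.der I := by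
    rintro j u ⟨k, hk⟩
    -- Differentiating `a_i ^ k u = 0` leaves a term with `a_i ^ (k - 1) u`; one more factor `a_i`
    -- kills it.
    refine ⟨k + 1, ?_⟩
    have h1 := congrArg (S.der j) hk
    rw [Derivation.leibniz, map_zero, Derivation.leibniz_pow, nsmul_eq_mul] at h1
    simp only [smul_eq_mul] at h1
    rcases k with _ | k
    · rw [Nat.cast_zero, zero_mul, mul_zero, add_zero, pow_zero, one_mul] at h1
      rw [h1, mul_zero]
    · rw [Nat.add_sub_cancel] at h1
      linear_combination S.a i * h1 - (k + 1 : ℕ) * S.der j (S.a i) * hk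
  rcases hD I hIP hID with hI | hI
  · have : d ∈ I := ⟨k, h⟩
    rwa [hI, Ideal.mem_bot] at this
  · exfalso
    obtain ⟨l, hl⟩ : (1 : D) ∈ I := hI ▸ Submodule.mem_top
    rw [mul_one] at hl
    induction l with
    | zero => simp at hl
    | succ l ih =>
      refine ih ?_
      have h1 := congrArg (S.der i) hl
      rw [Derivation.leibniz_pow, map_zero, nsmul_eq_mul, Nat.add_sub_cancel, smul_eq_mul] at h1
      have h2 := (isUnit_natCast (D := D) hF i (Nat.succ_ne_zero l)).mul_right_eq_zero.mp h1
      obtain ⟨r, t, hrt⟩ : ∃ r t, r * S.a i + t * S.der i (S.a i) = 1 := by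
        have h3 := (Ideal.eq_top_iff_one _).mp (ha i)
        rw [← Ideal.span_union, Set.singleton_union] at h3
        exact Ideal.mem_span_pair.mp h3
      rw [pow_succ] at hl
      linear_combination r * hl + t * h2 - S.a i ^ l * hrt

/-! ### Normal forms -/

variable (S)

/-- The element `X_i ^ k` for `k ≥ 0`, and `Y_i ^ (-k)` for `k < 0`. -/
noncomputable def gen (i : Fin n) (k : ℤ) : GWPA S := x S i ^ k.toNat * y S i ^ (-k).toNat

/-- The product of the elements `gen S i (γ i)`. -/
noncomputable def genProd (γ : Fin n → ℤ) : GWPA S := ∏ i, gen S i (γ i)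

theorem gen_mul_x (i : Fin n) (k : ℤ) : ∃ e, gen S i k * x S i = ofD S e * gen S i (k + 1) := by
  rcases le_or_gt 0 k with hk | hk
  · refine ⟨1, ?_⟩
    rw [gen, gen, ofD_one, show (k + 1).toNat = k.toNat + 1 by omega,
      show (-k).toNat = 0 by omega, show (-(k + 1)).toNat = 0 by omega, pow_succ]
    ring
  · refine ⟨S.a i, ?_⟩
    rw [gen, gen, ← x_mul_y, show (k + 1).toNat = 0 by omega, show k.toNat = 0 by omega,
      show (-k).toNat = (-(k + 1)).toNat + 1 by omega, pow_succ]
    ring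

theorem gen_mul_y (i : Fin n) (k : ℤ) : ∃ e, gen S i k * y S i = ofD S e * gen S i (k - 1) := by
  rcases le_or_gt k 0 with hk | hk
  · refine ⟨1, ?_⟩
    rw [gen, gen, ofD_one, show (-(k - 1)).toNat = (-k).toNat + 1 by omega,
      show k.toNat = 0 by omega, show (k - 1).toNat = 0 by omega, pow_succ]
    ring
  · refine ⟨S.a i, ?_⟩
    rw [gen, gen, ← x_mul_y, show (-(k - 1)).toNat = 0 by omega, show (-k).toNat = 0 by omega,
      show k.toNat = (k - 1).toNat + 1 by omega, pow_succ]
    ring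

theorem genProd_mul {i : Fin n} {γ : Fin n → ℤ} {k : ℤ} {t : GWPA S} {e : D}
    (h : gen S i (γ i) * t = ofD S e * gen S i k) :
    genProd S γ * t = ofD S e * genProd S (Function.update γ i k) := by
  have hu : genProd S (Function.update γ i k)
      = gen S i k * ∏ j ∈ Finset.univ.erase i, gen S j (γ j) := by
    rw [genProd, ← Finset.mul_prod_erase _ _ (Finset.mem_univ i), Function.update_self]
    congr 1
    refine Finset.prod_congr rfl fun j hj => ?_
    rw [Function.update_of_ne (Finset.ne_of_mem_erase hj)]
  rw [hu, genProd, ← Finset.mul_prod_erase _ _ (Finset.mem_univ i)]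
  linear_combination (∏ j ∈ Finset.univ.erase i, gen S j (γ j)) * h

/-- The additive map that sends a family of coefficients to the combination of the
elements `genProd S γ`. -/
noncomputable def combine : ((Fin n → ℤ) →₀ D) →+ GWPA S :=
  Finsupp.liftAddHom fun γ =>
    (AddMonoidHom.mulRight (genProd S γ)).comp (ofDHom S).toAddMonoidHom

theorem combine_apply (g : (Fin n → ℤ) →₀ D) :
    combine S g = g.sum fun γ d => ofD S d * genProd S γ := rfl

theorem combine_single (γ : Fin n → ℤ) (d : D) :
    combine S (Finsupp.single γ d) = ofD S d * genProd S γ :=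
  Finsupp.liftAddHom_apply_single _ _ _

/-- The combinations contain `D` and are stable under multiplication by each generator, which shifts
one exponent by one. Only spanning is needed later, not linear independence. -/
theorem combine_surjective : Function.Surjective (combine S) := by
  have key : ∀ (t : GWPA S) (i : Fin n),
      (∀ k, ∃ e l, gen S i k * t = ofD S e * gen S i l) →
      ∀ u, (∃ g, combine S g = u) → ∃ g, combine S g = u * t := by
    rintro t i ht _ ⟨g, rfl⟩
    induction g using Finsupp.induction_linear with
    | zero => exact ⟨0, by simp⟩
    | add f g hf hg =>
      obtain ⟨f', hf'⟩ := hf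
      obtain ⟨g', hg'⟩ := hg
      exact ⟨f' + g', by rw [map_add, map_add, hf', hg', add_mul]⟩
    | single γ d =>
      obtain ⟨e, l, h⟩ := ht (γ i)
      refine ⟨Finsupp.single (Function.update γ i l) (d * e), ?_⟩
      rw [combine_single, combine_single, mul_assoc, genProd_mul S h, ofD_mul, mul_assoc]
  intro u
  induction u using induction with
  | hD d => exact ⟨Finsupp.single 0 d, by rw [combine_single]; simp [genProd, gen]⟩
  | hadd u v hu hv =>
    obtain ⟨f, hf⟩ := hu
    obtain ⟨g, hg⟩ := hv
    exact ⟨f + g, by rw [map_add, hf, hg]⟩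
  | hx u i hu => exact key _ i (fun k => (gen_mul_x S i k).imp fun e he => ⟨_, he⟩) u hu
  | hy u i hu => exact key _ i (fun k => (gen_mul_y S i k).imp fun e he => ⟨_, he⟩) u hu

/-- The monomial in the `X_i` with exponent `β`. -/
noncomputable def xmon (β : Fin n → ℕ) : GWPA S := ∏ i, x S i ^ β i

/-- The element `X_1 ⋯ X_n`. -/
noncomputable def xprod : GWPA S := ∏ i, x S i

/-- The additive map that sends a family of coefficients to the corresponding polynomial in
the `X_i`. -/
noncomputable def xpoly : ((Fin n → ℕ) →₀ D) →+ GWPA S :=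
  Finsupp.liftAddHom fun β =>
    (AddMonoidHom.mulRight (xmon S β)).comp (ofDHom S).toAddMonoidHom

theorem xpoly_apply (f : (Fin n → ℕ) →₀ D) :
    xpoly S f = f.sum fun β d => ofD S d * xmon S β := rfl

theorem xpoly_single (β : Fin n → ℕ) (d : D) :
    xpoly S (Finsupp.single β d) = ofD S d * xmon S β :=
  Finsupp.liftAddHom_apply_single _ _ _

theorem xpoly_eq_sum {f : (Fin n → ℕ) →₀ D} {s : Finset (Fin n → ℕ)} (h : f.support ⊆ s) :
    xpoly S f = ∑ β ∈ s, ofD S (f β) * xmon S β := by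
  rw [xpoly_apply]
  exact Finsupp.sum_of_support_subset _ h _ fun _ _ => by rw [ofD_zero, zero_mul]

theorem xprod_pow_mul_xmon (N : ℕ) (β : Fin n → ℕ) :
    xprod S ^ N * xmon S β = xmon S (fun i => N + β i) := by
  simp only [xprod, xmon, ← Finset.prod_pow, ← Finset.prod_mul_distrib, pow_add]

/-- Each `Y_i` is absorbed by one `X_i` at the cost of a factor `a_i`; the bound on `k` leaves
enough factors `X_i`. -/
theorem x_pow_mul_gen (i : Fin n) {N : ℕ} {k : ℤ} (h : k.natAbs ≤ N) :
    x S i ^ N * gen S i k = ofD S (S.a i ^ (-k).toNat) * x S i ^ (N + k).toNat := by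
  rw [gen, ← ofDHom_apply, map_pow, ofDHom_apply, ← x_mul_y]
  rcases le_or_gt 0 k with hk | hk
  · rw [show (-k).toNat = 0 by omega, show (N + k).toNat = N + k.toNat by omega, pow_add]
    ring
  · rw [show N = (N + k).toNat + (-k).toNat by omega, show k.toNat = 0 by omega,
      show (((N + k).toNat + (-k).toNat : ℕ) + k).toNat = (N + k).toNat by omega, pow_add]
    ring

theorem xprod_pow_mul_genProd {N : ℕ} {γ : Fin n → ℤ} (h : ∀ i, (γ i).natAbs ≤ N) :
    xprod S ^ N * genProd S γ
      = ofD S (∏ i, S.a i ^ (-γ i).toNat) * xmon S (fun i => (N + γ i).toNat) := by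
  rw [xprod, genProd, xmon, ← ofDHom_apply, map_prod, ← Finset.prod_pow,
    ← Finset.prod_mul_distrib, ← Finset.prod_mul_distrib]
  exact Finset.prod_congr rfl fun i _ => x_pow_mul_gen S i (h i)

variable {S}

/-- A nonzero element of `A`, multiplied by a power of `X_1 ⋯ X_n`, is a nonzero polynomial in
the `X_i`, provided that the `a_i` are regular. -/
theorem exists_xprod_pow_mul_eq_xpoly
    (hreg : ∀ i (k : ℕ) (d : D), S.a i ^ k * d = 0 → d = 0) {u : GWPA S} (hu : u ≠ 0) :
    ∃ N f, f ≠ 0 ∧ xprod S ^ N * u = xpoly S f := by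
  classical
  obtain ⟨g, rfl⟩ := combine_surjective S u
  have hg : g ≠ 0 := fun h => hu (by rw [h, map_zero])
  obtain ⟨γ₀, hγ₀⟩ := Finsupp.support_nonempty_iff.mpr hg
  -- A crude bound for all exponents that occur. It prevents truncation in `N + γ i`, so distinct
  -- `γ` in the support give distinct monomials and no coefficients merge.
  let N := ∑ γ ∈ g.support, ∑ i, (γ i).natAbs
  have hN : ∀ γ ∈ g.support, ∀ i, (γ i).natAbs ≤ N := fun γ hγ i =>
    (Finset.single_le_sum (f := fun i => (γ i).natAbs) (fun _ _ => Nat.zero_le _)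
      (Finset.mem_univ i)).trans
    (Finset.single_le_sum (f := fun γ : Fin n → ℤ => ∑ i, (γ i).natAbs)
      (fun _ _ => Nat.zero_le _) hγ)
  let β : (Fin n → ℤ) → Fin n → ℕ := fun γ i => (N + γ i).toNat
  have hβ : ∀ γ ∈ g.support, β γ = β γ₀ → γ = γ₀ := fun γ hγ h => funext fun i => by
    have h1 := congrFun h i
    have h2 := hN γ hγ i
    have h3 := hN γ₀ hγ₀ i
    simp only [β] at h1
    omega
  have hprod : ∀ (s : Finset (Fin n)) (k : Fin n → ℕ) (d : D),
      (∏ i ∈ s, S.a i ^ k i) * d = 0 → d = 0 := by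
    intro s k d
    induction s using Finset.induction_on with
    | empty => simp
    | insert i s hi ih =>
      rw [Finset.prod_insert hi, mul_assoc]
      exact fun h => ih (hreg i _ _ h)
  refine ⟨N, ∑ γ ∈ g.support,
    Finsupp.single (β γ) ((∏ i, S.a i ^ (-γ i).toNat) * g γ), fun h => ?_, ?_⟩
  · have h1 := DFunLike.congr_fun h (β γ₀)
    rw [Finsupp.finsetSum_apply, Finset.sum_eq_single γ₀, Finsupp.single_eq_same,
      Finsupp.zero_apply] at h1
    · exact Finsupp.mem_support_iff.mp hγ₀ (hprod _ _ _ h1)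
    · exact fun γ hγ hne => Finsupp.single_eq_of_ne fun h => hne (hβ γ hγ h.symm)
    · exact fun h => absurd hγ₀ h
  · rw [map_sum, combine_apply, Finsupp.sum, Finset.mul_sum]
    refine Finset.sum_congr rfl fun γ hγ => ?_
    rw [xpoly_single, ofD_mul]
    linear_combination ofD S (g γ) * xprod_pow_mul_genProd S (hN γ hγ)

variable (S)

/-! ### Brackets of monomials in the `X_i` -/

theorem ofD_sum {ι : Type*} (s : Finset ι) (f : ι → D) :
    ofD S (∑ i ∈ s, f i) = ∑ i ∈ s, ofD S (f i) := map_sum (ofDHom S) f s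

theorem ofD_natCast (m : ℕ) : ofD S (m : D) = m := map_natCast (ofDHom S) m

theorem ofD_sub (d e : D) : ofD S (d - e) = ofD S d - ofD S e := map_sub (ofDHom S) d e

/-- The derivation `∑ i, β_i ∂_i` of `D`. -/
def weightDer (β : Fin n → ℕ) (d : D) : D := ∑ i, (β i : D) * S.der i d

/-- Each `X_i` is an eigenvector of `{d, ·}` with eigenvalue `∂_i(d)`, and eigenvalues add over the
factors of a monomial. -/
theorem pbr_ofD_xmon (d : D) (β : Fin n → ℕ) :
    pbr K (ofD S d) (xmon S β) = ofD S (weightDer S β d) * xmon S β := by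
  rw [xmon, pbr_prod_right _ _ _ (fun i => β i * ofD S (S.der i d))
    fun i _ => pbr_pow_of_pbr_eq (pbr_ofD_x S i d) _, weightDer, ofD_sum]
  simp only [ofD_mul, ofD_natCast]

theorem pbr_x_xmon (i : Fin n) (β : Fin n → ℕ) : pbr K (x S i) (xmon S β) = 0 := by
  rw [xmon, pbr_prod_right _ _ _ (fun _ => 0)
    fun j _ => by rw [pbr_pow_right, pbr_x_x, mul_zero, zero_mul]]
  simp

theorem xprod_eq_xmon : xprod S = xmon S 1 := by simp [xprod, xmon]

theorem pbr_ofD_xprod_pow (d : D) (N : ℕ) :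
    pbr K (ofD S d) (xprod S ^ N) = N * ofD S (weightDer S 1 d) * xprod S ^ N :=
  pbr_pow_of_pbr_eq (by rw [xprod_eq_xmon, pbr_ofD_xmon]) N

theorem pbr_x_xprod_pow (i : Fin n) (N : ℕ) : pbr K (x S i) (xprod S ^ N) = 0 := by
  rw [pbr_pow_right, xprod_eq_xmon, pbr_x_xmon, mul_zero]

theorem pbr_sum_right {P ι : Type*} [CommRing P] [Algebra K P] [PoissonAlgebra K P]
    (s : Finset ι) (u : P) (f : ι → P) : pbr K u (∑ i ∈ s, f i) = ∑ i ∈ s, pbr K u (f i) :=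
  map_sum _ _ _

/-- `X_i` commutes with every monomial in the `X_j`, so the bracket only differentiates
coefficients. -/
theorem pbr_x_xpoly {i : Fin n} {f h : (Fin n → ℕ) →₀ D} (hh : ∀ β, h β = S.der i (f β)) :
    pbr K (x S i) (xpoly S f) = -(x S i * xpoly S h) := by
  have hs : h.support ⊆ f.support := fun β hβ => by
    rw [Finsupp.mem_support_iff] at hβ ⊢
    exact fun h0 => hβ (by rw [hh, h0, map_zero])
  rw [xpoly_eq_sum S hs, xpoly_eq_sum S subset_rfl, pbr_sum_right, Finset.mul_sum,
    ← Finset.sum_neg_distrib]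
  refine Finset.sum_congr rfl fun β _ => ?_
  rw [pbr_mul_right, pbr_x_xmon, pbr_x_ofD, hh]
  ring

theorem pbr_ofD_xpoly {d : D} {f h : (Fin n → ℕ) →₀ D}
    (hh : ∀ β, h β = pbr K d (f β) + weightDer S β d * f β) :
    pbr K (ofD S d) (xpoly S f) = xpoly S h := by
  have hs : h.support ⊆ f.support := fun β hβ => by
    rw [Finsupp.mem_support_iff] at hβ ⊢
    exact fun h0 => hβ (by rw [hh, h0, pbr_zero_right, mul_zero, add_zero])
  rw [xpoly_eq_sum S hs, xpoly_eq_sum S subset_rfl, pbr_sum_right]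
  refine Finset.sum_congr rfl fun β _ => ?_
  rw [pbr_mul_right, pbr_ofD_xmon, pbr_ofD, hh, ofD_add, ofD_mul]
  ring

theorem xpoly_smul (d : D) (f : (Fin n → ℕ) →₀ D) : xpoly S (d • f) = ofD S d * xpoly S f := by
  rw [xpoly_eq_sum S (Finsupp.support_smul), xpoly_eq_sum S subset_rfl, Finset.mul_sum]
  refine Finset.sum_congr rfl fun β _ => ?_
  rw [Finsupp.smul_apply, smul_eq_mul, ofD_mul, mul_assoc]

/-! ### Saturation and elements of minimal support -/

/-- The polynomials in the `X_i` that lie in `J` after multiplication by a power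
of `X_1 ⋯ X_n`. -/
def saturation (J : Ideal (GWPA S)) : Submodule D ((Fin n → ℕ) →₀ D) where
  carrier := {f | ∃ N, xprod S ^ N * xpoly S f ∈ J}
  add_mem' := by
    rintro f g ⟨N, hN⟩ ⟨M, hM⟩
    refine ⟨N + M, ?_⟩
    have : xprod S ^ (N + M) * xpoly S (f + g) = xprod S ^ M * (xprod S ^ N * xpoly S f)
        + xprod S ^ N * (xprod S ^ M * xpoly S g) := by
      rw [map_add, pow_add]; ring
    rw [this]
    exact J.add_mem (J.mul_mem_left _ hN) (J.mul_mem_left _ hM)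
  zero_mem' := ⟨0, by simp⟩
  smul_mem' := by
    rintro d f ⟨N, hN⟩
    refine ⟨N, ?_⟩
    rw [xpoly_smul, mul_left_comm]
    exact J.mul_mem_left _ hN

variable {S}

/-- Bracketing with `X_i` applies `∂_i` to the coefficients but leaves a factor `X_i`. Multiplying
by the other variables turns it into `X_1 ⋯ X_n`, which saturation absorbs. -/
theorem der_mem_saturation {J : Ideal (GWPA S)} (hJ : IsPoissonIdeal K J) {i : Fin n}
    {f h : (Fin n → ℕ) →₀ D} (hf : f ∈ saturation S J) (hh : ∀ β, h β = S.der i (f β)) :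
    h ∈ saturation S J := by
  obtain ⟨N, hN⟩ := hf
  refine ⟨N + 1, ?_⟩
  have h1 := hJ (x S i) _ hN
  rw [pbr_mul_right, pbr_x_xprod_pow, zero_mul, zero_add, pbr_x_xpoly S hh] at h1
  have h2 : xprod S ^ (N + 1) * xpoly S h = -(∏ j ∈ Finset.univ.erase i, x S j)
      * (xprod S ^ N * -(x S i * xpoly S h)) := by
    have h3 : xprod S = x S i * ∏ j ∈ Finset.univ.erase i, x S j :=
      (Finset.mul_prod_erase _ _ (Finset.mem_univ i)).symm
    rw [pow_succ]
    linear_combination xprod S ^ N * xpoly S h * h3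
  rw [h2]
  exact J.mul_mem_left _ h1

/-- The bracket of `d` with the power of `X_1 ⋯ X_n` contributes only a multiple of the given
element of `J`. -/
theorem pbr_mem_saturation {J : Ideal (GWPA S)} (hJ : IsPoissonIdeal K J) {d : D}
    {f h : (Fin n → ℕ) →₀ D} (hf : f ∈ saturation S J)
    (hh : ∀ β, h β = pbr K d (f β) + weightDer S β d * f β) :
    h ∈ saturation S J := by
  obtain ⟨N, hN⟩ := hf
  refine ⟨N, ?_⟩
  have h1 := hJ (ofD S d) _ hN
  rw [pbr_mul_right, pbr_ofD_xprod_pow, pbr_ofD_xpoly S hh, mul_assoc] at h1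
  exact (J.add_mem_iff_right (J.mul_mem_left _ hN)).mp h1

/-- A nonzero stable family of polynomials contains a monic element of minimal support, whose
coefficients are semi-invariants. -/
theorem exists_semiinvariant
    (hD : ∀ I : Ideal D, IsPoissonIdeal K I → IsDerInvariant S.der I → I = ⊥ ∨ I = ⊤)
    (W : Submodule D ((Fin n → ℕ) →₀ D))
    (hder : ∀ (i : Fin n) (f h : (Fin n → ℕ) →₀ D), f ∈ W → (∀ β, h β = S.der i (f β)) → h ∈ W)
    (hpbr : ∀ (d : D) (f h : (Fin n → ℕ) →₀ D), f ∈ W →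
      (∀ β, h β = pbr K d (f β) + weightDer S β d * f β) → h ∈ W)
    (hW : W ≠ ⊥) :
    ∃ α, ∃ g ∈ W, g α = 1 ∧ (∀ i β, S.der i (g β) = 0) ∧
      ∀ d β, pbr K d (g β) + weightDer S β d * g β = weightDer S α d * g β := by
  obtain ⟨f, ⟨hfW, hf0⟩, hmin⟩ := (measure fun f : (Fin n → ℕ) →₀ D => f.support.card).wf.has_min
    {f | f ∈ W ∧ f ≠ 0} (Submodule.exists_mem_ne_zero_of_ne_bot hW)
  obtain ⟨α, hα⟩ := Finsupp.support_nonempty_iff.mpr hf0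
  -- Minimality of the support: losing the index `α` would give a strictly smaller one.
  have hzero : ∀ h ∈ W, h.support ⊆ f.support → h α = 0 → h = 0 := by
    intro h hh hs h0
    by_contra hne
    refine hmin h ⟨hh, hne⟩ (Finset.card_lt_card (Finset.ssubset_iff_subset_ne.mpr ⟨hs, ?_⟩))
    intro heq
    rw [← heq, Finsupp.mem_support_iff] at hα
    exact hα h0
  have hL : ∀ (d : D) (g : (Fin n → ℕ) →₀ D), g ∈ W → ∃ h ∈ W, h.support ⊆ g.support ∧
      ∀ β, h β = pbr K d (g β) + weightDer S β d * g β := by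
    intro d g hg
    let h : (Fin n → ℕ) →₀ D := Finsupp.onFinset g.support
      (fun β => pbr K d (g β) + weightDer S β d * g β) (fun β hβ => by
        rw [Finsupp.mem_support_iff]
        exact fun h0 => hβ (by rw [h0, pbr_zero_right, mul_zero, add_zero]))
    exact ⟨h, hpbr d g h hg fun _ => rfl, Finsupp.support_onFinset_subset, fun _ => rfl⟩
  have hdel : ∀ (i : Fin n) (g : (Fin n → ℕ) →₀ D), g ∈ W → ∃ h ∈ W, h.support ⊆ g.support ∧
      ∀ β, h β = S.der i (g β) := by
    intro i g hg
    let h : (Fin n → ℕ) →₀ D := Finsupp.mapRange (S.der i) (map_zero _) g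
    exact ⟨h, hder i g h hg fun _ => rfl, Finsupp.support_mapRange, fun _ => rfl⟩
  have hsub : ∀ {g h : (Fin n → ℕ) →₀ D}, g.support ⊆ f.support → h.support ⊆ f.support →
      (g - h).support ⊆ f.support := by
    intro g h hg hh β hβ
    by_contra hn
    rw [Finsupp.mem_support_iff, Finsupp.sub_apply,
      Finsupp.notMem_support_iff.mp fun h1 => hn (hg h1),
      Finsupp.notMem_support_iff.mp fun h1 => hn (hh h1), sub_zero] at hβ
    exact hβ rfl
  have hsmul : ∀ (d : D) {g : (Fin n → ℕ) →₀ D}, g.support ⊆ f.support →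
      (d • g).support ⊆ f.support := fun d _ hg => Finsupp.support_smul.trans hg
  -- The possible coefficients at `α` form a nonzero invariant Poisson ideal, so (a) provides a
  -- monic element. Subtracting `weightDer S α d • g` below leaves exactly `{d, g α}` at `α`.
  let I : Ideal D :=
    { carrier := {d | ∃ g ∈ W, g.support ⊆ f.support ∧ g α = d}
      add_mem' := by
        classical
        rintro _ _ ⟨g, hg, hgs, rfl⟩ ⟨h, hh, hhs, rfl⟩
        exact ⟨g + h, W.add_mem hg hh, Finsupp.support_add.trans (Finset.union_subset hgs hhs),
          rfl⟩
      zero_mem' := ⟨0, W.zero_mem, by simp, rfl⟩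
      smul_mem' := by
        rintro c _ ⟨g, hg, hgs, rfl⟩
        exact ⟨c • g, W.smul_mem c hg, hsmul c hgs, rfl⟩ }
  have hIP : IsPoissonIdeal K I := by
    rintro d _ ⟨g, hg, hgs, rfl⟩
    obtain ⟨h, hh, hhs, hhe⟩ := hL d g hg
    refine ⟨h - weightDer S α d • g, W.sub_mem hh (W.smul_mem _ hg),
      hsub (hhs.trans hgs) (hsmul _ hgs), ?_⟩
    rw [Finsupp.sub_apply, Finsupp.smul_apply, hhe, smul_eq_mul, add_sub_cancel_right]
  have hID : IsDerInvariant S.der I := by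
    rintro i _ ⟨g, hg, hgs, rfl⟩
    obtain ⟨h, hh, hhs, hhe⟩ := hdel i g hg
    exact ⟨h, hh, hhs.trans hgs, hhe α⟩
  have hI1 : (1 : D) ∈ I := by
    rcases hD I hIP hID with h | h
    · have h1 : f α ∈ I := ⟨f, hfW, subset_rfl, rfl⟩
      rw [h, Ideal.mem_bot] at h1
      exact absurd h1 (Finsupp.mem_support_iff.mp hα)
    · rw [h]; trivial
  obtain ⟨g, hg, hgs, hgα⟩ := hI1
  -- Derivations and brackets kill the coefficient `1` at `α`, so by `hzero` both resulting families
  -- vanish identically.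
  refine ⟨α, g, hg, hgα, fun i β => ?_, fun d β => ?_⟩
  · obtain ⟨h, hh, hhs, hhe⟩ := hdel i g hg
    rw [← hhe, hzero h hh (hhs.trans hgs) (by rw [hhe, hgα, Derivation.map_one_eq_zero]),
      Finsupp.zero_apply]
  · obtain ⟨h, hh, hhs, hhe⟩ := hL d g hg
    have h0 := hzero (h - weightDer S α d • g) (W.sub_mem hh (W.smul_mem _ hg))
      (hsub (hhs.trans hgs) (hsmul _ hgs)) (by
        rw [Finsupp.sub_apply, Finsupp.smul_apply, hhe, hgα, smul_eq_mul, pbr_one_right]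
        ring)
    have h1 := DFunLike.congr_fun h0 β
    rw [Finsupp.sub_apply, Finsupp.smul_apply, hhe, smul_eq_mul, Finsupp.zero_apply] at h1
    exact sub_eq_zero.mp h1

/-! ### Semi-invariants yield central elements -/

theorem weightDer_a (β : Fin n → ℕ) (j : Fin n) :
    weightDer S β (S.a j) = β j * S.der j (S.a j) := by
  rw [weightDer, Finset.sum_eq_single j]
  · exact fun i _ hij => by rw [S.der_a i j hij, mul_zero]
  · exact fun h => absurd (Finset.mem_univ j) h

/-- By (a) a nonzero `c` is a unit. Testing the relation on `a_i` gives `∂_i(a_i) = 0` wherever `β i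
≠ α i`, so there `a_i` is a unit by (b). Then `c` times the monomial of exponent `β - α`, with `Y_i`
replacing inverse powers of `X_i`, is central: the two weights cancel. Its evaluations take every
nonzero value, contradicting (c). -/
theorem semiinvariant_eq_zero
    (hD : ∀ I : Ideal D, IsPoissonIdeal K I → IsDerInvariant S.der I → I = ⊥ ∨ I = ⊤)
    (ha : ∀ i, Ideal.span {S.a i} ⊔ Ideal.span {S.der i (S.a i)} = ⊤)
    (hF : IsField (center K (GWPA S))) [Nontrivial D] {α β : Fin n → ℕ} (hαβ : β ≠ α) {c : D}
    (hder : ∀ i, S.der i c = 0)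
    (hpbr : ∀ d, pbr K d c + weightDer S β d * c = weightDer S α d * c) : c = 0 := by
  by_contra hc
  obtain ⟨j, hj⟩ := Function.ne_iff.mp hαβ
  have hunit : IsUnit c := by
    have hP : IsPoissonIdeal K (Ideal.span {c}) := fun d e he => by
      refine pbr_mem_span ?_ he
      rintro _ rfl
      rw [eq_sub_of_add_eq (hpbr d), ← sub_mul]
      exact Ideal.mul_mem_left _ _ (Ideal.mem_span_singleton_self _)
    have hI : IsDerInvariant S.der (Ideal.span {c}) := fun i d hd => by
      obtain ⟨e, rfl⟩ := Ideal.mem_span_singleton'.mp hd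
      rw [Derivation.leibniz, hder, smul_zero, zero_add, smul_eq_mul]
      exact Ideal.mul_mem_right _ _ (Ideal.mem_span_singleton_self _)
    rcases hD _ hP hI with h | h
    · exact absurd (Ideal.span_singleton_eq_bot.mp h) hc
    · exact Ideal.span_singleton_eq_top.mp h
  have hda : ∀ i, β i ≠ α i → S.der i (S.a i) = 0 := by
    intro i hi
    have h := hpbr (S.a i)
    have h1 : pbr K (S.a i) c = 0 := S.a_mem i c
    rw [h1, weightDer_a, weightDer_a, zero_add, ← sub_eq_zero, ← sub_mul, ← sub_mul] at h
    exact (isUnit_natCast_sub hF j hi).mul_right_eq_zero.mp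
      (hunit.mul_left_eq_zero.mp h)
  have hua : ∀ i, β i ≠ α i → IsUnit (S.a i) := by
    intro i hi
    have h := ha i
    rw [hda i hi, Ideal.span_singleton_zero, sup_bot_eq] at h
    exact Ideal.span_singleton_eq_top.mp h
  -- Truncated differences: for each `i` at least one of `p i`, `q i` vanishes.
  let p : Fin n → ℕ := fun i => β i - α i
  let q : Fin n → ℕ := fun i => α i - β i
  let z : GWPA S := ofD S c * ∏ i, x S i ^ p i * y S i ^ q i
  have hz : z ∈ center K (GWPA S) := by
    refine mem_center (fun d => ?_) (fun i => ?_) (fun i => ?_)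
    · have h1 : ∀ i, pbr K (ofD S d) (x S i ^ p i * y S i ^ q i)
          = ofD S (((β i : D) - α i) * S.der i d) * (x S i ^ p i * y S i ^ q i) := by
        intro i
        have h2 : (β i : D) - α i = p i - q i := by
          rcases le_total (α i) (β i) with h | h
          · simp [p, q, h]
          · simp [p, q, h]
        have h3 : pbr K (ofD S d) (y S i) = -ofD S (S.der i d) * y S i := by
          rw [pbr_ofD_y, neg_mul]
        rw [pbr_mul_right, pbr_pow_of_pbr_eq (pbr_ofD_x S i d), pbr_pow_of_pbr_eq h3, h2,
          ofD_mul, ofD_sub, ofD_natCast, ofD_natCast]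
        ring
      have h2 : (∑ i, ofD S (((β i : D) - α i) * S.der i d))
          = ofD S (weightDer S β d - weightDer S α d) := by
        rw [← ofD_sum, weightDer, weightDer, ← Finset.sum_sub_distrib]
        simp only [sub_mul]
      rw [pbr_mul_right, pbr_prod_right _ _ _ _ fun i _ => h1 i, h2, pbr_ofD,
        eq_sub_of_add_eq (hpbr d), ofD_sub, ofD_sub, ofD_mul, ofD_mul]
      ring
    · have h1 : ∀ j, pbr K (x S i) (x S j ^ p j * y S j ^ q j) 
          = 0 * (x S j ^ p j * y S j ^ q j) := by
        intro j
        rw [pbr_mul_right, pbr_pow_right, pbr_x_x, pbr_pow_right, pbr_x_y]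
        by_cases h : i = j
        · subst h
          -- Either the exponent of `Y_i` is zero, or the bracket `{X_i, Y_i}` vanishes because
          -- `∂_i(a_i) = 0`.
          by_cases hi : β i = α i
          · simp [q, hi]
          · simp [hda i hi, ofD_zero]
        · simp [h]
      rw [pbr_mul_right, pbr_prod_right _ _ _ _ fun j _ => h1 j, pbr_x_ofD, hder, ofD_zero]
      simp
    · have h1 : ∀ j, pbr K (y S i) (x S j ^ p j * y S j ^ q j) 
          = 0 * (x S j ^ p j * y S j ^ q j) := by
        intro j
        rw [pbr_mul_right, pbr_pow_right, pbr_pow_right, pbr_y_y, pbr_y_x]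
        by_cases h : i = j
        · subst h
          by_cases hi : β i = α i
          · simp [p, hi]
          · simp [hda i hi, ofD_zero]
        · simp [h]
      rw [pbr_mul_right, pbr_prod_right _ _ _ _ fun j _ => h1 j, pbr_y_ofD, hder, ofD_zero]
      simp
  obtain ⟨L, _, _, ⟨φ⟩⟩ := exists_hom_to_isAlgClosed D
  have := IsAlgClosed.instInfinite (K := L)
  -- The value of `z` at `s = 1`; it is nonzero since `a_i` is a unit whenever `q i ≠ 0`.
  let b : L := φ c * ∏ i, φ (S.a i) ^ q i
  have hb : b ≠ 0 := by
    refine mul_ne_zero (hunit.map φ).ne_zero (Finset.prod_ne_zero_iff.mpr fun i _ => ?_)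
    by_cases hi : β i = α i
    · simp [q, hi]
    · exact pow_ne_zero _ ((hua i hi).map φ).ne_zero
  have heval : ∀ (s : L) (hs : s ≠ 0), evalAt S φ j hs z = b * (s ^ p j * s⁻¹ ^ q j) := by
    intro s hs
    have h1 : ∏ i, (if i = j then s else 1) ^ p i * (if i = j then s else 1)⁻¹ ^ q i
        = s ^ p j * s⁻¹ ^ q j := by
      rw [Finset.prod_eq_single j]
      · simp
      · exact fun i _ hij => by simp [hij]
      · exact fun h => absurd (Finset.mem_univ j) h
    simp only [z, b, evalAt, map_mul, map_prod, map_pow, lift_ofD, lift_x, lift_y]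
    rw [← h1, mul_assoc, ← Finset.prod_mul_distrib]
    congr 1
    refine Finset.prod_congr rfl fun i _ => ?_
    rw [mul_pow]
    ring
  refine not_isField_center (L := L) hz (fun w hw => ?_) hF
  rcases lt_or_gt_of_ne hj with h | h
  · have hq : q j ≠ 0 := by simp only [q]; omega
    have hp : p j = 0 := by simp only [p]; omega
    obtain ⟨s, hs⟩ := IsAlgClosed.exists_pow_nat_eq (w / b) (Nat.pos_of_ne_zero hq)
    have hs0 : s ≠ 0 := by
      rintro rfl
      rw [zero_pow hq] at hs
      exact div_ne_zero hw hb hs.symm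
    refine ⟨evalAt S φ j (inv_ne_zero hs0), ?_⟩
    rw [heval, hp, inv_inv, hs, pow_zero, one_mul, mul_div_cancel₀ _ hb]
  · have hq : q j = 0 := by simp only [q]; omega
    have hp : p j ≠ 0 := by simp only [p]; omega
    obtain ⟨s, hs⟩ := IsAlgClosed.exists_pow_nat_eq (w / b) (Nat.pos_of_ne_zero hp)
    have hs0 : s ≠ 0 := by
      rintro rfl
      rw [zero_pow hp] at hs
      exact div_ne_zero hw hb hs.symm
    refine ⟨evalAt S φ j hs0, ?_⟩
    rw [heval, hq, hs, pow_zero, mul_one, mul_div_cancel₀ _ hb]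

/-! ### Lowering monomials -/

/-- From `X_i ^ (k + 1) r`, multiplication by `Y_i` gives `a_i X_i ^ k r`, and the bracket with
`Y_i` gives `(k + 1) ∂_i(a_i) X_i ^ k r`. Since `k + 1` is invertible, (b) combines these to `X_i ^
k r`. -/
theorem mem_of_x_pow_mul_mem
    (ha : ∀ i, Ideal.span {S.a i} ⊔ Ideal.span {S.der i (S.a i)} = ⊤)
    (hF : IsField (center K (GWPA S))) {J : Ideal (GWPA S)} (hJ : IsPoissonIdeal K J)
    {i : Fin n} {r : GWPA S} (hr : pbr K (y S i) r = 0) {k : ℕ} (h : x S i ^ k * r ∈ J) :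
    r ∈ J := by
  induction k with
  | zero => simpa using h
  | succ k ih =>
    refine ih ?_
    obtain ⟨e, t, het⟩ : ∃ e t, e * S.a i + t * S.der i (S.a i) = 1 := by
      have h3 := (Ideal.eq_top_iff_one _).mp (ha i)
      rw [← Ideal.span_union, Set.singleton_union] at h3
      exact Ideal.mem_span_pair.mp h3
    obtain ⟨m, hm⟩ := isUnit_iff_exists_inv.mp
      (isUnit_natCast (D := D) hF i (Nat.succ_ne_zero k))
    have h1 := hJ (y S i) _ h
    rw [pbr_mul_right, hr, mul_zero, add_zero, pbr_pow_right, pbr_y_x, if_pos rfl,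
      Nat.add_sub_cancel] at h1
    have h2 := congrArg (ofD S) het
    have h3 := congrArg (ofD S) hm
    rw [ofD_add, ofD_mul, ofD_mul, ofD_one, ← x_mul_y] at h2
    rw [ofD_mul, ofD_natCast, ofD_one] at h3
    have h4 : x S i ^ k * r = ofD S e * y S i * (x S i ^ (k + 1) * r) + ofD S (t * m)
        * (((k + 1 : ℕ) : GWPA S) * x S i ^ k * ofD S (S.der i (S.a i)) * r) := by
      rw [ofD_mul, pow_succ]
      linear_combination -(x S i ^ k * r) * h2
        - ofD S t * x S i ^ k * ofD S (S.der i (S.a i)) * r * h3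
    rw [h4]
    exact J.add_mem (J.mul_mem_left _ h) (J.mul_mem_left _ h1)

/-- Variables are removed one at a time: the remaining product involves only `X_j` with `j ≠ i`,
which commute with `Y_i`. -/
theorem one_mem_of_xmon_mem
    (ha : ∀ i, Ideal.span {S.a i} ⊔ Ideal.span {S.der i (S.a i)} = ⊤)
    (hF : IsField (center K (GWPA S))) {J : Ideal (GWPA S)} (hJ : IsPoissonIdeal K J)
    {β : Fin n → ℕ} (h : xmon S β ∈ J) : 1 ∈ J := by
  suffices ∀ s : Finset (Fin n), ∏ i ∈ s, x S i ^ β i ∈ J → 1 ∈ J from this Finset.univ h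
  intro s
  induction s using Finset.induction_on with
  | empty => simp
  | insert i s hi ih =>
    intro hs
    rw [Finset.prod_insert hi] at hs
    refine ih (mem_of_x_pow_mul_mem ha hF hJ ?_ hs)
    rw [pbr_prod_right _ _ _ (fun _ => 0) fun j hj => ?_]
    · simp
    · rw [pbr_pow_right, pbr_y_x, if_neg (show ¬ i = j from fun h => hi (h ▸ hj)), mul_zero, zero_mul]

/-- The generalized Weyl Poisson algebra is Poisson simple under the criterion. -/
theorem isPoissonSimple
    (hD : ∀ I : Ideal D, IsPoissonIdeal K I → IsDerInvariant S.der I → I = ⊥ ∨ I = ⊤)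
    (ha : ∀ i, Ideal.span {S.a i} ⊔ Ideal.span {S.der i (S.a i)} = ⊤)
    (hF : IsField (center K (GWPA S))) [Nontrivial D] (J : Ideal (GWPA S))
    (hJ : IsPoissonIdeal K J) : J = ⊥ ∨ J = ⊤ := by
  refine or_iff_not_imp_left.mpr fun hne => ?_
  obtain ⟨u, huJ, hu0⟩ := Submodule.exists_mem_ne_zero_of_ne_bot hne
  obtain ⟨N, f, hf0, hf⟩ := exists_xprod_pow_mul_eq_xpoly
    (fun i _ _ h => eq_zero_of_a_pow_mul_eq_zero hD ha hF i h) hu0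
  have hfW : f ∈ saturation S J := ⟨0, by
    rw [pow_zero, one_mul, ← hf]; exact J.mul_mem_left _ huJ⟩
  have hW : saturation S J ≠ ⊥ := fun h => hf0 (by rwa [h, Submodule.mem_bot] at hfW)
  obtain ⟨α, g, hg, hgα, hgder, hgpbr⟩ := exists_semiinvariant hD (saturation S J)
    (fun _ _ _ => der_mem_saturation hJ) (fun _ _ _ => pbr_mem_saturation hJ) hW
  -- Any other coefficient is semi-invariant of a different weight and therefore zero.
  have hgs : g = Finsupp.single α 1 := by
    ext β
    by_cases h : β = α
    · rw [h, hgα, Finsupp.single_eq_same]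
    · rw [Finsupp.single_eq_of_ne h]
      exact semiinvariant_eq_zero hD ha hF h (fun i => hgder i β) (fun d => hgpbr d β)
  obtain ⟨M, hM⟩ := hg
  rw [hgs, xpoly_single, ofD_one, one_mul, xprod_pow_mul_xmon] at hM
  exact (Ideal.eq_top_iff_one J).mpr (one_mem_of_xmon_mem ha hF hJ hM)

end GWPA

/-! ### The simplicity criterion -/

theorem corollary4p5 {K D : Type*} [Field K] [CommRing D] [Algebra K D] [PoissonAlgebra K D]
    {n : ℕ} (S : GWPAData K D n) :
    IsSimpleRing (PoissonEnv K (GWPA S)) ↔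
      (∀ I : Ideal D, PoissonAlgebra.IsPoissonIdeal K I → IsDerInvariant S.der I → I = ⊥ ∨ I = ⊤) ∧
      (∀ i, Ideal.span {S.a i} ⊔ Ideal.span {S.der i (S.a i)} = ⊤) ∧
      IsField (PoissonAlgebra.center K (GWPA S)) ∧
      FaithfulSMul (PoissonEnv K (GWPA S)) (GWPA S) := by
  rw [PoissonEnv.isSimpleRing_iff]
  constructor
  · rintro ⟨⟨hnt, hA⟩, hf⟩
    exact ⟨GWPA.eq_bot_or_eq_top_of_isPoissonSimple hA, GWPA.sup_eq_top_of_isPoissonSimple hA,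
      isField_center hA, hf⟩
  · rintro ⟨hD, ha, hF, hf⟩
    -- Condition (a) allows `D = 0`; it is (c) that makes `A`, and hence `D`, nonzero.
    have hnt : Nontrivial (GWPA S) := by
      obtain ⟨u, v, huv⟩ := hF.exists_pair_ne
      exact ⟨u, v, fun h => huv (Subtype.ext h)⟩
    have := GWPA.nontrivial_base S
    exact ⟨⟨hnt, GWPA.isPoissonSimple hD ha hF⟩, hf⟩
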